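/- Let $n \ge 1$, let $\mathbb B$ and $\mathbb S$ be the open unit ball and the unit sphere of $\mathbb R^n$, and let $dx'$ be the surface measure on $\mathbb S$, scaled so that $r^{n-1}\,dr\,dx'$ is the Lebesgue measure on $\mathbb B$ normalized to total mass $1$. For a (real- or complex-valued) harmonic function $f$ on $\mathbb B$ and $0 \le r < 1$ put $M_1(f,r) = \int_{\mathbb S} |f(rx')|\,dx'$. For $\alpha > 0$ and $p>0$ let $B^{\infty,1}_\alpha$ be the space of harmonic functions $f$ on $\mathbb B$ with $$\|f\|_{B^{\infty,1}_\alpha} = \sup_{0\le r<1} M_1(f,r)(1-r)^\alpha < \infty,$$ let $B^{p,1}_\alpha$ be the space of harmonic functions $f$ on $\mathbb B$ with $$\|f\|_{B^{p,1}_\alpha} = \left(\int_0^1 M_1(f,r)^p (1-r)^{\alpha p-1}\,dr\right)^{1/p} < \infty,$$ and for $\varepsilon > 0$ let $L_{\varepsilon,\alpha}(f) = \{ r \in [0,1) : (1-r)^\alpha M_1(f,r) \ge \varepsilon \}$. Let $0 < p \le 1$, $\alpha > 0$ and $t > \alpha - 1$. For $f \in B^{\infty,1}_\alpha$ set $$\hat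 s_1(f) = \operatorname{dist}_{B^{\infty,1}_\alpha}(f, B^{p,1}_\alpha) = \inf_{g \in B^{p,1}_\alpha} \|f-g\|_{B^{\infty,1}_\alpha},$$ $$\hat s_2(f) = \inf\left\{ \varepsilon > 0 : \int_0^1 \left( \int_0^1 \chi_{L_{\varepsilon,\alpha}(f)}(r) \frac{(1-r)^{t-\alpha}}{(1-r\rho)^{t+1}}\,dr \right)^p (1-\rho)^{p\alpha-1}\,d\rho < \infty \right\}.$$ Then $\hat s_1(f) \asymp \hat s_2(f)$: there is a constant $C$, depending only on $\alpha$, $n$, $p$ and $t$, such that $\hat s_1(f) \le C\,\hat s_2(f)$ and $\hat s_2(f) \le C\,\hat s_1(f)$ for every $f \in B^{\infty,1}_\alpha$. -/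

import Mathlib

open MeasureTheory Set
open scoped ENNReal NNReal

noncomputable section

namespace HarmonicDist

/-- The space `ℝⁿ` with the Euclidean norm. -/
abbrev E (n : ℕ) : Type := EuclideanSpace ℝ (Fin n)

/-- The surface measure `dx'` on the unit sphere of `ℝⁿ`, scaled so that `r ^ (n - 1) dr dx'` is the
normalized Lebesgue measure of the unit ball (of total mass one). -/
def sphereMeasure (n : ℕ) : Measure (Metric.sphere (0 : E n) 1) :=
  (volume (Metric.ball (0 : E n) 1))⁻¹ • (volume : Measure (E n)).toSphere

variable {n : ℕ} {𝕜 : Type*} [RCLike 𝕜]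

/-- `f` is harmonic on the open unit ball; only the values of `f` in the ball matter. -/
def IsHarmonicOnBall (f : E n → 𝕜) : Prop :=
  InnerProductSpace.HarmonicOnNhd f (Metric.ball (0 : E n) 1)

/-- The integral mean `M₁(f, r)`, the integral of `|f(r x')|` over the unit sphere. -/
def M1 (f : E n → 𝕜) (r : ℝ) : ℝ≥0∞ :=
  ∫⁻ x : Metric.sphere (0 : E n) 1, ‖f (r • (x : E n))‖ₑ ∂(sphereMeasure n)

/-- The norm of `B^{∞,1}_α`: the supremum of `M₁(f, r) (1 - r) ^ α` over `0 ≤ r < 1`. -/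
def normBInf (α : ℝ) (f : E n → 𝕜) : ℝ≥0∞ :=
  ⨆ r ∈ Ico (0 : ℝ) 1, M1 f r * ENNReal.ofReal ((1 - r) ^ α)

/-- The (quasi-)norm of `B^{p,1}_α`. -/
def normB (p α : ℝ) (f : E n → 𝕜) : ℝ≥0∞ :=
  (∫⁻ r in Ioo (0 : ℝ) 1, M1 f r ^ p * ENNReal.ofReal ((1 - r) ^ (α * p - 1))) ^ (1 / p)

/-- The space `B^{∞,1}_α`. -/
def BInf (n : ℕ) (𝕜 : Type*) [RCLike 𝕜] (α : ℝ) : Set (E n → 𝕜) :=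
  {f | IsHarmonicOnBall f ∧ normBInf α f < ∞}

/-- The space `B^{p,1}_α`. -/
def B (n : ℕ) (𝕜 : Type*) [RCLike 𝕜] (p α : ℝ) : Set (E n → 𝕜) :=
  {f | IsHarmonicOnBall f ∧ normB p α f < ∞}

/-- The distance in `B^{∞,1}_α` from `f` to `B^{p,1}_α`. -/
def s1 (p α : ℝ) (f : E n → 𝕜) : ℝ≥0∞ :=
  ⨅ g ∈ B n 𝕜 p α, normBInf α (f - g)

/-- The set `L_{ε,α}(f)` of all `r` in `[0, 1)` with `(1 - r) ^ α M₁(f, r) ≥ ε`. -/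
def L (ε α : ℝ) (f : E n → 𝕜) : Set ℝ :=
  {r | r ∈ Ico (0 : ℝ) 1 ∧ ENNReal.ofReal ε ≤ ENNReal.ofReal ((1 - r) ^ α) * M1 f r}

/-- The iterated integral whose finiteness is required in the definition of `s2`. -/
def levelIntegral (p α t ε : ℝ) (f : E n → 𝕜) : ℝ≥0∞ :=
  ∫⁻ ρ in Ioo (0 : ℝ) 1,
    (∫⁻ r in Ioo (0 : ℝ) 1,
      (L ε α f).indicator
        (fun r => ENNReal.ofReal ((1 - r) ^ (t - α) / (1 - r * ρ) ^ (t + 1))) r) ^ p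
      * ENNReal.ofReal ((1 - ρ) ^ (p * α - 1))

/-- The infimum of all `ε > 0` for which the iterated integral is finite. -/
def s2 (p α t : ℝ) (f : E n → 𝕜) : ℝ≥0∞ :=
  ⨅ (ε : ℝ) (_ : 0 < ε ∧ levelIntegral p α t ε f < ∞), ENNReal.ofReal ε

end HarmonicDist

end

/-!
Write `N` for the Euler operator `f ↦ x · ∇f` and `T = (N + 1)(N + 2)⋯(N + m + 1)` for an integer
`m ≥ t`. Integration by parts along rays gives the reproducing formula
`m! f(x) = ∫₀¹ 2r (1 - r²)^m (T f)(r² x) dr` (`integral_radialDeriv_eq`). It plays the role of a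
weighted Bergman projection, with the kernel estimate replaced by
`M₁(T f, rρ) ≤ C (1 - ρ)^{-m-1} M₁(f, r)` (`exists_M1_radialDeriv_le`).

*Upper bound for the distance.* Split the formula into the parts over `L = L_{ε,α}(f)` and over its
complement. Both parts are harmonic (`harmonicAt_rayIntegral`) and their integral means are at most
a constant times `∫ M₁(f, r) (1 - r)^m (1 - rρ)^{-m-1} dr` over the set in question
(`exists_M1_rayPart_le`). Off `L` one has `M₁(f, r) ≤ ε (1 - r)^{-α}`, and the Forelli–Rudin
estimate makes that part at most `C ε` in `B^{∞,1}_α`. On `L` one has `M₁(f, r) ≤ C (1 - r)^{-α}`;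
as `1 - r ≤ 1 - rρ`, the kernel with exponent `m` is at most the one with exponent `t`, so that
part is in `B^{p,1}_α` when the level integral is finite.

*Lower bound.* If `‖f - g‖ < ε` with `g ∈ B^{p,1}_α`, then `(1 - r)^α M₁(g, r)` is bounded below on
`L`, and the level integral is dominated by a Hardy-type integral of `M₁(g, ·)`. For `p ≤ 1` this
is controlled by the norm of `g` in `B^{p,1}_α`, by a dyadic decomposition
(`exists_lintegral_kernel_rpow_le`) which uses that `M₁(g, ·)` is increasing. Hence `s2 ≤ s1`, with
constant one.

The facts about harmonic functions come from the mean value property against a smooth radial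
kernel, `integral_radialBump_smul_comp`: smoothness, the gradient estimate, and the sub-mean value
inequality for `M₁(f, ·)`. The latter uses rotation invariance of the surface measure
(`lintegral_sphere_radial_convolution`) and gives the monotonicity of `M₁(f, ·)`
(`monotoneOn_M1`) by the maximum principle.
-/

noncomputable section

set_option linter.unusedSectionVars false

/-! ### The mean value property -/

namespace HarmonicDist

open Metric Topology InnerProductSpace
open scoped ContDiff Laplacian

section MeanValue

variable {V : Type*} [NormedAddCommGroup V] [InnerProductSpace ℝ V]
  {W : Type*} [NormedAddCommGroup W] [NormedSpace ℝ W]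

/-- A smooth radial function supported in the closed unit ball, whose gradient at `z` is
`-2 • radialBump z • z`. -/
def radialPotential (z : V) : ℝ := expNegInvGlue (1 - ‖z‖ ^ 2)

/-- A smooth radial kernel, positive exactly on the open unit ball. It is not normalized to have
integral one. -/
def radialBump (z : V) : ℝ := deriv expNegInvGlue (1 - ‖z‖ ^ 2)

lemma deriv_expNegInvGlue_of_nonpos {x : ℝ} (hx : x ≤ 0) : deriv expNegInvGlue x = 0 := by
  have h : HasDerivWithinAt expNegInvGlue 0 (Iic x) x := by
    refine (hasDerivWithinAt_const x (Iic x) (0 : ℝ)).congr (fun y hy => ?_) ?_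
    · exact expNegInvGlue.zero_of_nonpos (le_trans hy hx)
    · exact expNegInvGlue.zero_of_nonpos hx
  have hd : DifferentiableAt ℝ expNegInvGlue x :=
    (expNegInvGlue.contDiff (n := 1)).differentiable (by norm_num) x
  exact ((uniqueDiffWithinAt_Iic x).eq_deriv _ h hd.hasDerivAt.hasDerivWithinAt).symm

lemma deriv_expNegInvGlue_of_pos {x : ℝ} (hx : 0 < x) : 0 < deriv expNegInvGlue x := by
  have h : HasDerivAt expNegInvGlue (Real.exp (-x⁻¹) * (x ^ 2)⁻¹) x := by
    have h1 : HasDerivAt (fun y : ℝ => Real.exp (-y⁻¹)) (Real.exp (-x⁻¹) * (x ^ 2)⁻¹) x := by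
      have := ((hasDerivAt_inv hx.ne').neg).exp
      simpa using this
    refine h1.congr_of_eventuallyEq ?_
    filter_upwards [lt_mem_nhds hx] with y hy
    simp [expNegInvGlue, not_le.2 hy]
  rw [h.deriv]
  positivity

lemma contDiff_radialPotential : ContDiff ℝ ∞ (radialPotential : V → ℝ) :=
  (expNegInvGlue.contDiff (n := ⊤)).comp (contDiff_const.sub (contDiff_norm_sq ℝ))

lemma contDiff_radialBump : ContDiff ℝ ∞ (radialBump : V → ℝ) := by
  have h : ContDiff ℝ ∞ (deriv expNegInvGlue) :=
    ((contDiff_succ_iff_deriv (n := ∞)).1 (expNegInvGlue.contDiff (n := ⊤))).2.2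
  exact h.comp (contDiff_const.sub (contDiff_norm_sq ℝ))

lemma continuous_radialBump : Continuous (radialBump : V → ℝ) := contDiff_radialBump.continuous

lemma radialBump_of_one_le {z : V} (hz : 1 ≤ ‖z‖) : radialBump z = 0 :=
  deriv_expNegInvGlue_of_nonpos (by nlinarith)

lemma radialPotential_of_one_le {z : V} (hz : 1 ≤ ‖z‖) : radialPotential z = 0 :=
  expNegInvGlue.zero_of_nonpos (by nlinarith)

lemma radialBump_pos {z : V} (hz : ‖z‖ < 1) : 0 < radialBump z :=
  deriv_expNegInvGlue_of_pos (by nlinarith [norm_nonneg z])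

lemma radialBump_nonneg (z : V) : 0 ≤ radialBump z := by
  rcases lt_or_ge ‖z‖ 1 with h | h
  · exact (radialBump_pos h).le
  · exact (radialBump_of_one_le h).ge

lemma fderiv_radialPotential (z v : V) :
    fderiv ℝ radialPotential z v = -2 * radialBump z * inner ℝ z v := by
  have h1 : HasFDerivAt (fun z : V => 1 - ‖z‖ ^ 2) (-(2 • innerSL ℝ z)) z := by
    simpa using (hasStrictFDerivAt_norm_sq z).hasFDerivAt.const_sub 1
  have hd : DifferentiableAt ℝ expNegInvGlue (1 - ‖z‖ ^ 2) :=
    (expNegInvGlue.contDiff (n := 1)).differentiable (by norm_num) _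
  have h2 := hd.hasDerivAt.comp_hasFDerivAt z h1
  have h3 : HasFDerivAt radialPotential
      (deriv expNegInvGlue (1 - ‖z‖ ^ 2) • (-(2 • innerSL ℝ z) : V →L[ℝ] ℝ)) z := h2
  rw [h3.fderiv]
  simp [radialBump]
  ring

lemma tsupport_subset_closedBall {φ : V → ℝ} (h : ∀ z, 1 ≤ ‖z‖ → φ z = 0) :
    tsupport φ ⊆ closedBall 0 1 := by
  refine closure_minimal (fun z hz => ?_) isClosed_closedBall
  by_contra hz'
  exact hz (h z (by simpa using (not_le.1 (by simpa using hz')).le))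

variable [FiniteDimensional ℝ V]

lemma hasCompactSupport_radialBump : HasCompactSupport (radialBump : V → ℝ) :=
  (isCompact_closedBall 0 1).of_isClosed_subset (isClosed_tsupport _)
    (tsupport_subset_closedBall fun _ => radialBump_of_one_le)

variable [MeasurableSpace V] [BorelSpace V]

lemma integrable_smul_of_continuousOn {φ : V → ℝ} (hφ : Continuous φ)
    (h : ∀ z, 1 ≤ ‖z‖ → φ z = 0) {G : V → W} (hG : ContinuousOn G (closedBall 0 1)) :
    Integrable (fun z => φ z • G z) := by
  have h1 : IntegrableOn (fun z => φ z • G z) (closedBall 0 1) :=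
    (hφ.continuousOn.smul hG).integrableOn_compact (isCompact_closedBall _ _)
  refine (integrableOn_iff_integrable_of_support_subset fun z hz => ?_).1 h1
  by_contra hz'
  have : 1 ≤ ‖z‖ := by
    have := not_le.1 (by simpa using hz'); exact this.le
  exact hz (by simp [h z this])

lemma integrable_radialBump : Integrable (radialBump : V → ℝ) :=
  continuous_radialBump.integrable_of_hasCompactSupport hasCompactSupport_radialBump

lemma integral_radialBump_pos : 0 < ∫ z : V, radialBump z := by
  refine (integral_pos_iff_support_of_nonneg radialBump_nonneg integrable_radialBump).2 ?_
  have : ball (0 : V) 1 ⊆ Function.support radialBump := fun z hz =>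
    (radialBump_pos (by simpa using hz)).ne'
  exact (isOpen_ball.measure_pos volume ⟨0, by simp⟩).trans_le (measure_mono this)

/-- The flux identity `∫ ψ(z) Df(x + s z) z dz = 0` for harmonic `f`: the vector field
`ψ(z) z` is a gradient, so it is orthogonal to the gradients of harmonic functions. -/
lemma integral_radialBump_smul_fderiv {f : V → W} {x : V} {s δ : ℝ} (hs : |s| ≤ δ)
    (hf : ∀ z ∈ closedBall x δ, HarmonicAt f z) :
    ∫ z, radialBump z • fderiv ℝ f (x + s • z) z = 0 := by
  have hmem : ∀ z ∈ closedBall (0 : V) 1, x + s • z ∈ closedBall x δ := by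
    intro z hz
    have hz : ‖z‖ ≤ 1 := by simpa using hz
    have : |s| * ‖z‖ ≤ δ := by nlinarith [abs_nonneg s]
    simpa [norm_smul] using this
  set b := stdOrthonormalBasis ℝ V with hb
  have hmap : Continuous fun z : V => x + s • z := by fun_prop
  have hdiff : ∀ z ∈ closedBall (0 : V) 1, ContDiffAt ℝ 1 (fderiv ℝ f) (x + s • z) := fun z hz =>
    (hf _ (hmem z hz)).1.fderiv_right (by norm_num)
  have hg : ∀ i, ∀ z ∈ closedBall (0 : V) 1,
      HasFDerivAt (fun z => fderiv ℝ f (x + s • z) (b i))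
        (s • ((fderiv ℝ (fderiv ℝ f) (x + s • z)).flip (b i))) z := by
    intro i z hz
    have h1 := ((hdiff z hz).differentiableAt (by norm_num)).hasFDerivAt
    have h2 : HasFDerivAt (fun z : V => x + s • z) (s • ContinuousLinearMap.id ℝ V) z :=
      ((hasFDerivAt_id z).const_smul s).const_add x
    have h3 := (h1.comp z h2).clm_apply (hasFDerivAt_const (b i) z)
    refine h3.congr_fderiv ?_
    ext v
    simp
  have hcontD : ContinuousOn (fun z => fderiv ℝ f (x + s • z)) (closedBall 0 1) := fun z hz =>
    ((hdiff z hz).continuousAt.comp (f := fun z : V => x + s • z)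
      hmap.continuousAt).continuousWithinAt
  have hcontD2 : ContinuousOn (fun z => fderiv ℝ (fderiv ℝ f) (x + s • z)) (closedBall 0 1) :=
    fun z hz => ((((hdiff z hz).fderiv_right (m := 0) (by norm_num)).continuousAt).comp
      (f := fun z : V => x + s • z) hmap.continuousAt).continuousWithinAt
  have hΦ : ContDiff ℝ ∞ (radialPotential : V → ℝ) := contDiff_radialPotential
  -- integrate the potential of the kernel by parts in the `i`-th coordinate direction
  have hIBP : ∀ i, ∫ z, radialPotential z • (s • fderiv ℝ (fderiv ℝ f) (x + s • z) (b i) (b i)) =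
      ∫ z, (2 * radialBump z * inner ℝ z (b i)) • fderiv ℝ f (x + s • z) (b i) := by
    intro i
    have hcontΦ' : Continuous fun z : V => fderiv ℝ radialPotential z (b i) :=
      (hΦ.continuous_fderiv (by simp)).clm_apply continuous_const
    have hg0 : ContinuousOn (fun z => fderiv ℝ f (x + s • z) (b i)) (closedBall 0 1) :=
      hcontD.clm_apply continuousOn_const
    have hg1 : ContinuousOn (fun z => s • fderiv ℝ (fderiv ℝ f) (x + s • z) (b i) (b i))
        (closedBall 0 1) :=
      continuousOn_const.smul
        ((hcontD2.clm_apply continuousOn_const).clm_apply continuousOn_const)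
    have heq : ∀ z : V, radialPotential z • fderiv ℝ (fun z => fderiv ℝ f (x + s • z) (b i)) z (b i)
        = radialPotential z • (s • fderiv ℝ (fderiv ℝ f) (x + s • z) (b i) (b i)) := by
      intro z
      by_cases hz : z ∈ closedBall (0 : V) 1
      · rw [(hg i z hz).fderiv]; simp
      · have : 1 ≤ ‖z‖ := by
          have := not_le.1 (by simpa using hz); exact this.le
        simp [radialPotential_of_one_le this]
    have h := integral_smul_fderiv_eq_neg_fderiv_smul_of_integrable (μ := (volume : Measure V))
      (f := (radialPotential : V → ℝ)) (g := fun z => fderiv ℝ f (x + s • z) (b i)) (v := b i)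
      (integrable_smul_of_continuousOn hcontΦ' (fun z hz => by
        rw [fderiv_radialPotential, radialBump_of_one_le hz]; simp) hg0)
      (by
        simp_rw [heq]
        exact integrable_smul_of_continuousOn hΦ.continuous
          (fun z hz => radialPotential_of_one_le hz) hg1)
      (integrable_smul_of_continuousOn hΦ.continuous
        (fun z hz => radialPotential_of_one_le hz) hg0)
      (fun z _ => hΦ.differentiable (by simp) z)
      (fun z hz => (hg i z (tsupport_subset_closedBall
        (fun z hz => radialPotential_of_one_le hz) hz)).differentiableAt)
    simp_rw [heq] at h
    rw [h, ← integral_neg]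
    congr 1
    ext z
    rw [fderiv_radialPotential, ← neg_smul]
    congr 1
    ring
  have hint1 : ∀ i ∈ Finset.univ, Integrable fun z =>
      radialPotential z • (s • fderiv ℝ (fderiv ℝ f) (x + s • z) (b i) (b i)) := fun i _ =>
    integrable_smul_of_continuousOn hΦ.continuous (fun z hz => radialPotential_of_one_le hz)
      (continuousOn_const.smul
        ((hcontD2.clm_apply continuousOn_const).clm_apply continuousOn_const))
  have hint2 : ∀ i ∈ Finset.univ, Integrable fun z : V =>
      (2 * radialBump z * inner ℝ z (b i)) • fderiv ℝ f (x + s • z) (b i) := fun i _ =>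
    integrable_smul_of_continuousOn
      ((continuous_const.mul continuous_radialBump).mul (continuous_id.inner continuous_const))
      (fun z hz => by simp [radialBump_of_one_le hz]) (hcontD.clm_apply continuousOn_const)
  have hsum : ∫ z, ∑ i, radialPotential z • (s • fderiv ℝ (fderiv ℝ f) (x + s • z) (b i) (b i)) =
      ∫ z, ∑ i, (2 * radialBump z * inner ℝ z (b i)) • fderiv ℝ f (x + s • z) (b i) := by
    rw [integral_finsetSum _ hint1, integral_finsetSum _ hint2]
    exact Finset.sum_congr rfl fun i _ => hIBP i
  have hL : ∀ z : V, ∑ i, radialPotential z • (s • fderiv ℝ (fderiv ℝ f) (x + s • z) (b i) (b i))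
      = 0 := by
    intro z
    by_cases hz : z ∈ closedBall (0 : V) 1
    · have hlap : Δ f (x + s • z) = 0 := (hf _ (hmem z hz)).2.self_of_nhds
      rw [laplacian_eq_iteratedFDeriv_orthonormalBasis f b] at hlap
      rw [← Finset.smul_sum, ← Finset.smul_sum]
      simp only [iteratedFDeriv_two_apply] at hlap
      simp at hlap
      simp [hlap]
    · have : 1 ≤ ‖z‖ := by
        have := not_le.1 (by simpa using hz); exact this.le
      simp [radialPotential_of_one_le this]
  have hR : ∀ z : V, ∑ i, (2 * radialBump z * inner ℝ z (b i)) • fderiv ℝ f (x + s • z) (b i) =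
      (2 : ℝ) • (radialBump z • fderiv ℝ f (x + s • z) z) := by
    intro z
    conv_rhs => rw [← b.sum_repr' z]
    rw [map_sum, Finset.smul_sum, Finset.smul_sum]
    refine Finset.sum_congr rfl fun i _ => ?_
    rw [map_smul, smul_smul, smul_smul, real_inner_comm, b.sum_repr' z, mul_assoc]
  simp_rw [hL, hR] at hsum
  rw [integral_smul] at hsum
  simpa using hsum.symm

/-- The mean value property of harmonic functions against the radial kernel `radialBump`: by the
flux identity, the integral does not depend on the scale `δ`. -/
theorem integral_radialBump_smul_comp {f : V → W} [CompleteSpace W] {x : V} {δ : ℝ} (hδ : 0 ≤ δ)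
    (hf : ∀ z ∈ closedBall x δ, HarmonicAt f z) :
    ∫ z, radialBump z • f (x + δ • z) = (∫ z : V, radialBump z) • f x := by
  have hmem : ∀ s ∈ Icc (-δ) δ, ∀ z ∈ closedBall (0 : V) 1, x + s • z ∈ closedBall x δ := by
    intro s hs z hz
    have hz : ‖z‖ ≤ 1 := by simpa using hz
    have : |s| * ‖z‖ ≤ δ := by nlinarith [abs_nonneg s, abs_le.2 hs]
    simpa [norm_smul] using this
  have hcont : ContinuousOn f (closedBall x δ) := fun z hz =>
    (hf z hz).1.continuousAt.continuousWithinAt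
  have hcontD : ContinuousOn (fderiv ℝ f) (closedBall x δ) := fun z hz =>
    ((hf z hz).1.fderiv_right (m := 1) (by norm_num)).continuousAt.continuousWithinAt
  obtain ⟨C, hC⟩ := (isCompact_closedBall x δ).exists_bound_of_continuousOn hcont
  obtain ⟨C', hC'⟩ := (isCompact_closedBall x δ).exists_bound_of_continuousOn hcontD
  have hint : ∀ s ∈ Icc (-δ) δ, Integrable fun z => radialBump z • f (x + s • z) := fun s hs =>
    integrable_smul_of_continuousOn continuous_radialBump (fun z hz => radialBump_of_one_le hz)
      (hcont.comp (by fun_prop) fun z hz => hmem s hs z hz)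
  have hint' : ∀ s ∈ Icc (-δ) δ, Integrable fun z => radialBump z • fderiv ℝ f (x + s • z) z :=
    fun s hs => integrable_smul_of_continuousOn continuous_radialBump
      (fun z hz => radialBump_of_one_le hz)
      ((hcontD.comp (by fun_prop) fun z hz => hmem s hs z hz).clm_apply continuousOn_id)
  set I : ℝ → W := fun s => ∫ z, radialBump z • f (x + s • z) with hI
  have hIcont : ContinuousOn I (Icc 0 δ) := by
    refine continuousOn_of_dominated (bound := fun z => radialBump z * C)
      (fun s hs => (hint s ⟨by linarith [hs.1], hs.2⟩).aestronglyMeasurable) ?_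
      (integrable_radialBump.mul_const _) ?_
    · intro s hs
      refine Filter.Eventually.of_forall fun z => ?_
      by_cases hz : ‖z‖ < 1
      · rw [norm_smul, Real.norm_of_nonneg (radialBump_nonneg z)]
        exact mul_le_mul_of_nonneg_left (hC _ (hmem s ⟨by linarith [hs.1], hs.2⟩ z
          (by simpa using hz.le))) (radialBump_nonneg z)
      · simp [radialBump_of_one_le (not_lt.1 hz)]
    · refine Filter.Eventually.of_forall fun z => ?_
      by_cases hz : ‖z‖ < 1
      · exact continuousOn_const.smul (hcont.comp (by fun_prop) fun s hs =>
          hmem s ⟨by linarith [hs.1], hs.2⟩ z (by simpa using hz.le))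
      · simp [radialBump_of_one_le (not_lt.1 hz), continuousOn_const]
  have hIderiv : ∀ s ∈ Ico 0 δ, HasDerivWithinAt I 0 (Ici s) s := by
    intro s hs
    have hs' : s ∈ Ioo (-δ) δ := ⟨by linarith [hs.1, hs.2], hs.2⟩
    have h := (hasDerivAt_integral_of_dominated_loc_of_deriv_le
      (F := fun s z => radialBump z • f (x + s • z))
      (F' := fun s z => radialBump z • fderiv ℝ f (x + s • z) z) (μ := (volume : Measure V))
      (bound := fun z => radialBump z * C') (x₀ := s) (s := Ioo (-δ) δ)
      (Ioo_mem_nhds hs'.1 hs'.2)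
      (by
        filter_upwards [Ioo_mem_nhds hs'.1 hs'.2] with u hu
        exact (hint u (Ioo_subset_Icc_self hu)).aestronglyMeasurable)
      (hint s (Ioo_subset_Icc_self hs')) (hint' s (Ioo_subset_Icc_self hs')).aestronglyMeasurable
      (by
        refine Filter.Eventually.of_forall fun z u hu => ?_
        by_cases hz : ‖z‖ < 1
        · rw [norm_smul, Real.norm_of_nonneg (radialBump_nonneg z)]
          refine mul_le_mul_of_nonneg_left ?_ (radialBump_nonneg z)
          refine (ContinuousLinearMap.le_opNorm _ _).trans ?_
          have := hC' _ (hmem u (Ioo_subset_Icc_self hu) z (by simpa using hz.le))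
          nlinarith [norm_nonneg z, norm_nonneg (fderiv ℝ f (x + u • z))]
        · simp [radialBump_of_one_le (not_lt.1 hz)])
      (integrable_radialBump.mul_const _)
      (by
        refine Filter.Eventually.of_forall fun z u hu => ?_
        by_cases hz : ‖z‖ < 1
        · have h1 := ((hf _ (hmem u (Ioo_subset_Icc_self hu) z
            (by simpa using hz.le))).1.differentiableAt (by norm_num)).hasFDerivAt
          have h2 : HasDerivAt (fun u : ℝ => x + u • z) z u := by
            simpa using ((hasDerivAt_id u).smul_const z).const_add x
          exact (h1.comp_hasDerivAt u h2).const_smul _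
        · simpa [radialBump_of_one_le (not_lt.1 hz)] using hasDerivAt_const u (0 : W))).2
    rw [integral_radialBump_smul_fderiv (abs_le.2 (Ioo_subset_Icc_self hs')) hf] at h
    exact h.hasDerivWithinAt
  have := constant_of_has_deriv_right_zero hIcont hIderiv δ ⟨hδ, le_rfl⟩
  simp only [hI, zero_smul, add_zero] at this
  rw [this, integral_smul_const]

/-- The mean value property, written as a convolution. -/
theorem integral_radialBump_smul {f : V → W} [CompleteSpace W] {x : V} {δ : ℝ} (hδ : 0 < δ)
    (hf : ∀ z ∈ closedBall x δ, HarmonicAt f z) :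
    ∫ z, radialBump (δ⁻¹ • (x - z)) • f z =
      (δ ^ Module.finrank ℝ V * ∫ z : V, radialBump z) • f x := by
  have h1 : ∫ z, radialBump (δ⁻¹ • (x - z)) • f z
      = ∫ z, radialBump (δ⁻¹ • z) • f (x + δ • (δ⁻¹ • z)) := by
    rw [← integral_add_left_eq_self _ x]
    congr 1
    ext z
    rw [smul_inv_smul₀ hδ.ne', sub_add_cancel_left, smul_neg]
    simp [radialBump]
  rw [h1, Measure.integral_comp_smul volume (fun z => radialBump z • f (x + δ • z)) δ⁻¹,
    integral_radialBump_smul_comp hδ.le hf, smul_smul]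
  congr 2
  rw [inv_pow, inv_inv, abs_of_nonneg (by positivity)]

/-- Harmonic functions are smooth: by the mean value property they agree locally with a convolution
against a smooth kernel. -/
theorem _root_.InnerProductSpace.HarmonicAt.contDiffAt_infty [CompleteSpace W] {f : V → W} {x : V}
    (hf : HarmonicAt f x) : ContDiffAt ℝ ∞ f x := by
  obtain ⟨η, hη, hball⟩ := Metric.eventually_nhds_iff_ball.1 hf.eventually
  set δ := η / 3 with hδ
  have hδ0 : 0 < δ := by positivity
  set g : V → W := (closedBall x (2 * δ)).indicator f with hg
  have hgint : Integrable g := by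
    rw [hg, integrable_indicator_iff isClosed_closedBall.measurableSet]
    refine ContinuousOn.integrableOn_compact (isCompact_closedBall _ _) fun z hz =>
      (hball z ?_).1.continuousAt.continuousWithinAt
    have : dist z x ≤ 2 * δ := hz
    exact mem_ball.2 (by linarith)
  set k : V → ℝ := fun z => radialBump (δ⁻¹ • z) with hk
  have hksmooth : ContDiff ℝ ∞ k := contDiff_radialBump.comp (contDiff_id.const_smul _)
  have hkc : HasCompactSupport k :=
    hasCompactSupport_radialBump.comp_smul (inv_ne_zero hδ0.ne')
  have hconv := hkc.contDiff_convolution_left (ContinuousLinearMap.lsmul ℝ ℝ) hksmooth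
    hgint.locallyIntegrable (μ := volume)
  set c : ℝ := δ ^ Module.finrank ℝ V * ∫ z : V, radialBump z with hc
  have hc0 : c ≠ 0 := (mul_pos (by positivity) integral_radialBump_pos).ne'
  refine ((hconv.const_smul c⁻¹).contDiffAt (x := x)).congr_of_eventuallyEq ?_
  filter_upwards [Metric.ball_mem_nhds x hδ0] with y hy
  have hy : dist y x < δ := hy
  have hmv := integral_radialBump_smul (f := f) (x := y) hδ0 (fun z hz => hball z (by
    have : dist z y ≤ δ := hz
    exact mem_ball.2 (by linarith [dist_triangle z y x])))
  rw [convolution_eq_swap, eq_inv_smul_iff₀ hc0, ← hmv]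
  congr 1
  ext z
  simp only [hk, hg, ContinuousLinearMap.lsmul_apply]
  by_cases hz : z ∈ closedBall x (2 * δ)
  · rw [indicator_of_mem hz]
  · have hz' : 2 * δ < dist z x := by simpa using hz
    have h2 : δ < ‖y - z‖ := by
      rw [← dist_eq_norm, dist_comm]
      linarith [dist_triangle z y x]
    rw [radialBump_of_one_le, zero_smul, zero_smul]
    rw [norm_smul, norm_inv, Real.norm_of_nonneg hδ0.le, inv_mul_eq_div, le_div_iff₀ hδ0]
    linarith

end MeanValue

end HarmonicDist

/-! ### Rotation invariance and polar coordinates -/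

namespace HarmonicDist

open Metric Topology InnerProductSpace

section Rotation

variable {V : Type*} [NormedAddCommGroup V] [InnerProductSpace ℝ V] [FiniteDimensional ℝ V]
  [MeasurableSpace V] [BorelSpace V]

open scoped Pointwise in
/-- The surface measure of the sphere is invariant under linear isometries. -/
lemma lintegral_toSphere_comp_isometry (U : V ≃ₗᵢ[ℝ] V) {F : V → ℝ≥0∞} (hF : Measurable F) :
    ∫⁻ x : sphere (0 : V) 1, F (U x) ∂(volume : Measure V).toSphere =
      ∫⁻ x : sphere (0 : V) 1, F x ∂(volume : Measure V).toSphere := by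
  let u : sphere (0 : V) 1 → sphere (0 : V) 1 := fun x => ⟨U x, by simp⟩
  have hu : Measurable u := (U.continuous.comp continuous_subtype_val).measurable.subtype_mk
  have hmp : Measure.map u (volume : Measure V).toSphere = (volume : Measure V).toSphere := by
    ext s hs
    rw [Measure.map_apply hu hs, Measure.toSphere_apply' _ (hu hs), Measure.toSphere_apply' _ hs]
    congr 1
    have : (Ioo (0 : ℝ) 1 • ((↑) '' (u ⁻¹' s)) : Set V) = U ⁻¹' (Ioo (0 : ℝ) 1 • ((↑) '' s)) := by
      ext z
      simp only [mem_smul, mem_image, mem_preimage]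
      constructor
      · rintro ⟨a, ha, _, ⟨y, hy, rfl⟩, rfl⟩
        exact ⟨a, ha, U y, ⟨u y, hy, rfl⟩, by simp⟩
      · rintro ⟨a, ha, _, ⟨y, hy, rfl⟩, h⟩
        refine ⟨a, ha, U.symm y, ⟨⟨U.symm y, by simp⟩, ?_, rfl⟩, ?_⟩
        · have : u ⟨U.symm y, by simp⟩ = y := by ext; simp [u]
          rw [this]; exact hy
        · apply U.injective
          rw [map_smul, U.apply_symm_apply, h]
    rw [this]
    exact U.measurePreserving.measure_preimage_equiv (f := U.toHomeomorph.toMeasurableEquiv) _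
  have h2 := lintegral_map (μ := (volume : Measure V).toSphere)
    (hF.comp (measurable_subtype_coe (p := (· ∈ sphere (0 : V) 1)))) hu
  rw [hmp] at h2
  exact h2.symm

/-- Integration in polar coordinates. -/
lemma lintegral_eq_lintegral_polar [Nontrivial V] {G : V → ℝ≥0∞} (hG : Measurable G) :
    ∫⁻ z, G z = ∫⁻ r : Ioi (0 : ℝ), ∫⁻ x : sphere (0 : V) 1, G ((r : ℝ) • (x : V))
      ∂(volume : Measure V).toSphere ∂(Measure.volumeIoiPow (Module.finrank ℝ V - 1)) := by
  have hmp := (volume : Measure V).measurePreserving_homeomorphUnitSphereProd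
  have hm : Measurable fun p : sphere (0 : V) 1 × Ioi (0 : ℝ) => G ((p.2 : ℝ) • (p.1 : V)) :=
    hG.comp (by fun_prop)
  have h0 : ∫⁻ z, G z = ∫⁻ z : ({0}ᶜ : Set V), G z ∂((volume : Measure V).comap (↑)) := by
    rw [lintegral_subtype_comap (measurableSet_singleton _).compl, restrict_compl_singleton]
  rw [← lintegral_prod_symm' _ hm, ← hmp.lintegral_comp hm, h0]
  refine lintegral_congr fun z => ?_
  congr 1
  have hz : ‖(z : V)‖ ≠ 0 := norm_ne_zero_iff.2 z.2
  simp [hz]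

lemma norm_smul_sub_smul_comm {e x : V} (he : ‖e‖ = 1) (hx : ‖x‖ = 1) (a b : ℝ) :
    ‖a • e - b • x‖ = ‖a • x - b • e‖ := by
  rw [← sq_eq_sq₀ (norm_nonneg _) (norm_nonneg _), norm_sub_sq_real, norm_sub_sq_real]
  simp only [norm_smul, he, hx, inner_smul_left, inner_smul_right, real_inner_comm]

/-- Averaging a radial convolution over a sphere amounts to the radial convolution, at a single
point of that sphere, of the spherical means. -/
theorem lintegral_sphere_radial_convolution [Nontrivial V] {κ : ℝ → ℝ≥0∞} (hκ : Measurable κ)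
    {F : V → ℝ≥0∞} (hF : Measurable F) {e : V} (he : ‖e‖ = 1) (ρ : ℝ) :
    ∫⁻ x : sphere (0 : V) 1, (∫⁻ z, κ ‖ρ • (x : V) - z‖ * F z) ∂(volume : Measure V).toSphere =
      ∫⁻ z, κ ‖ρ • e - z‖ *
        ∫⁻ x : sphere (0 : V) 1, F (‖z‖ • (x : V)) ∂(volume : Measure V).toSphere := by
  set σ := (volume : Measure V).toSphere
  set K : V → ℝ≥0∞ := fun z => ∫⁻ x : sphere (0 : V) 1, κ ‖ρ • (x : V) - z‖ ∂σ with hK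
  have hKm : Measurable K := Measurable.lintegral_prod_right'
    (f := fun p : V × sphere (0 : V) 1 => κ ‖ρ • (p.2 : V) - p.1‖) (hκ.comp (by fun_prop))
  -- a reflection moves any unit vector to `e`
  have hKrad : ∀ (r : ℝ) (x : V), ‖x‖ = 1 → K (r • x) = K (r • e) := by
    intro r x hx
    set U := (ℝ ∙ (x - e))ᗮ.reflection
    have hU : U x = e := Submodule.reflection_sub (hx.trans he.symm)
    have h := lintegral_toSphere_comp_isometry U
      (F := fun y => κ ‖ρ • y - r • e‖) (hκ.comp (by fun_prop))
    simp only [hK]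
    rw [← h]
    refine lintegral_congr fun y => ?_
    rw [← hU, ← map_smul, ← map_smul, ← map_sub, LinearIsometryEquiv.norm_map]
  have hmean : Measurable fun r : ℝ => ∫⁻ x : sphere (0 : V) 1, F (r • (x : V)) ∂σ :=
    Measurable.lintegral_prod_right'
      (f := fun p : ℝ × sphere (0 : V) 1 => F (p.1 • (p.2 : V))) (hF.comp (by fun_prop))
  have hL : ∫⁻ x : sphere (0 : V) 1, (∫⁻ z, κ ‖ρ • (x : V) - z‖ * F z) ∂σ = ∫⁻ z, K z * F z := by
    rw [lintegral_lintegral_swap]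
    · refine lintegral_congr fun z => ?_
      rw [lintegral_mul_const]
      exact hκ.comp (by fun_prop)
    · exact ((hκ.comp (by fun_prop)).mul (hF.comp measurable_snd)).aemeasurable
  have hκe : Measurable fun z : V => κ ‖ρ • e - z‖ := hκ.comp (by fun_prop)
  rw [hL, lintegral_eq_lintegral_polar (G := fun z => K z * F z) (hKm.mul hF),
    lintegral_eq_lintegral_polar (G := fun z => κ ‖ρ • e - z‖ *
        ∫⁻ x : sphere (0 : V) 1, F (‖z‖ • (x : V)) ∂σ) (hκe.mul (hmean.comp measurable_norm))]
  refine lintegral_congr fun r => ?_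
  have h1 : ∀ x : sphere (0 : V) 1, K ((r : ℝ) • (x : V)) * F ((r : ℝ) • (x : V)) =
      K ((r : ℝ) • e) * F ((r : ℝ) • (x : V)) := fun x => by rw [hKrad r x (by simp)]
  have h2 : ∀ x : sphere (0 : V) 1, ‖(r : ℝ) • (x : V)‖ = r := fun x => by
    rw [norm_smul, norm_eq_of_mem_sphere, mul_one, Real.norm_of_nonneg (le_of_lt r.2)]
  simp_rw [h1, h2]
  have hm1 : Measurable fun x : sphere (0 : V) 1 => F ((r : ℝ) • (x : V)) :=
    hF.comp (by fun_prop)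
  have hm2 : Measurable fun x : sphere (0 : V) 1 => κ ‖ρ • e - (r : ℝ) • (x : V)‖ :=
    hκ.comp (by fun_prop)
  rw [lintegral_const_mul _ hm1, lintegral_mul_const _ hm2]
  congr 1
  simp only [hK]
  refine lintegral_congr fun x => ?_
  rw [norm_smul_sub_smul_comm he (by simp)]

end Rotation

end HarmonicDist

/-! ### Integral means of harmonic functions -/

namespace HarmonicDist

open Metric Topology InnerProductSpace

section IntegralMeans

variable {n : ℕ} {𝕜 : Type*} [RCLike 𝕜]

lemma isHarmonicOnBall_continuousOn {f : E n → 𝕜} (hf : IsHarmonicOnBall f) :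
    ContinuousOn f (ball 0 1) := HarmonicOnNhd.continuousOn hf

instance isFiniteMeasure_sphereMeasure : IsFiniteMeasure (sphereMeasure n) := by
  refine ⟨?_⟩
  rw [sphereMeasure, Measure.smul_apply, smul_eq_mul]
  refine ENNReal.mul_lt_top (ENNReal.inv_lt_top.2 ?_) (measure_lt_top _ _)
  exact isOpen_ball.measure_pos volume ⟨0, by simp⟩

lemma smul_mem_unitBall {r : ℝ} (hr : r ∈ Ico (0 : ℝ) 1) (x : sphere (0 : E n) 1) :
    r • (x : E n) ∈ ball (0 : E n) 1 := by
  simpa [norm_smul, abs_of_nonneg hr.1] using hr.2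

lemma measurable_indicator_unitBall {W : Type*} [NormedAddCommGroup W] {f : E n → W}
    (hf : ContinuousOn f (ball 0 1)) :
    Measurable ((ball (0 : E n) 1).indicator fun z => ‖f z‖ₑ) := by
  have h : ContinuousOn (fun z => ‖f z‖ₑ) (ball 0 1) := hf.enorm
  classical
  have := h.measurable_piecewise (g := fun _ => (0 : ℝ≥0∞)) continuousOn_const measurableSet_ball
  exact (piecewise_eq_indicator (s := ball (0 : E n) 1) (f := fun z => ‖f z‖ₑ)) ▸ this

/-- Averaging over the sphere of radius `ρ` the convolution of `‖f‖ₑ` with a radial kernel that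
does not reach outside the unit ball. -/
lemma lintegral_sphereMeasure_convolution [NeZero n] {κ : ℝ → ℝ≥0∞} (hκ : Measurable κ)
    {f : E n → 𝕜} (hf : ContinuousOn f (ball 0 1)) {e : E n} (he : ‖e‖ = 1) {ρ δ : ℝ}
    (hρ : 0 ≤ ρ) (hρδ : ρ + δ < 1) (hκδ : ∀ t, δ < t → κ t = 0) :
    ∫⁻ x : sphere (0 : E n) 1, (∫⁻ z, κ ‖ρ • (x : E n) - z‖ * ‖f z‖ₑ) ∂(sphereMeasure n) =
      ∫⁻ z, κ ‖ρ • e - z‖ * M1 f ‖z‖ := by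
  set F : E n → ℝ≥0∞ := (ball (0 : E n) 1).indicator fun z => ‖f z‖ₑ with hF
  have hFm : Measurable F := measurable_indicator_unitBall hf
  have hzero : ∀ x : E n, ‖x‖ = 1 → ∀ z ∉ ball (0 : E n) 1, κ ‖ρ • x - z‖ = 0 := by
    intro x hx z hz
    have hz : 1 ≤ ‖z‖ := by simpa using hz
    apply hκδ
    have h1 := norm_sub_norm_le z (ρ • x)
    rw [norm_smul, hx, mul_one, Real.norm_of_nonneg hρ] at h1
    rw [norm_sub_rev]
    linarith
  have h := lintegral_sphere_radial_convolution hκ hFm he ρ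
  have h1 : ∀ x : sphere (0 : E n) 1, ∫⁻ z, κ ‖ρ • (x : E n) - z‖ * ‖f z‖ₑ =
      ∫⁻ z, κ ‖ρ • (x : E n) - z‖ * F z := fun x => by
    refine lintegral_congr fun z => ?_
    by_cases hz : z ∈ ball (0 : E n) 1
    · rw [hF, indicator_of_mem hz]
    · rw [hzero x (by simp) z hz, zero_mul, zero_mul]
  have h2 : ∀ z : E n, κ ‖ρ • e - z‖ * M1 f ‖z‖ = (volume (ball (0 : E n) 1))⁻¹ *
      (κ ‖ρ • e - z‖ * ∫⁻ x : sphere (0 : E n) 1, F (‖z‖ • (x : E n))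
        ∂(volume : Measure (E n)).toSphere) := fun z => by
    by_cases hz : z ∈ ball (0 : E n) 1
    · have : ∀ x : sphere (0 : E n) 1, F (‖z‖ • (x : E n)) = ‖f (‖z‖ • (x : E n))‖ₑ := fun x => by
        rw [hF, indicator_of_mem (smul_mem_unitBall ⟨norm_nonneg z, by simpa using hz⟩ x)]
      simp_rw [this, M1, sphereMeasure, lintegral_smul_measure, smul_eq_mul]
      ring
    · rw [hzero e he z hz, zero_mul, zero_mul, mul_zero]
  have hmean : Measurable fun r : ℝ => ∫⁻ x : sphere (0 : E n) 1, F (r • (x : E n))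
        ∂(volume : Measure (E n)).toSphere :=
    Measurable.lintegral_prod_right'
      (f := fun p : ℝ × sphere (0 : E n) 1 => F (p.1 • (p.2 : E n))) (hFm.comp (by fun_prop))
  have hκe : Measurable fun z : E n => κ ‖ρ • e - z‖ := hκ.comp (by fun_prop)
  have hprod : Measurable fun z : E n => κ ‖ρ • e - z‖ * ∫⁻ x : sphere (0 : E n) 1,
      F (‖z‖ • (x : E n)) ∂(volume : Measure (E n)).toSphere :=
    hκe.mul (hmean.comp measurable_norm)
  simp_rw [h1, h2]
  rw [lintegral_const_mul _ hprod, ← h, sphereMeasure,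
    lintegral_smul_measure, smul_eq_mul]

lemma exists_norm_eq_one [NeZero n] : ∃ e : E n, ‖e‖ = 1 := exists_norm_eq _ zero_le_one

/-- The mass of the dilated kernel `z ↦ radialBump (δ⁻¹ • z)`. -/
def bumpMass (n : ℕ) (δ : ℝ) : ℝ≥0∞ := ENNReal.ofReal (δ ^ n * ∫ z : E n, radialBump z)

lemma bumpMass_ne_zero {δ : ℝ} (hδ : 0 < δ) : bumpMass n δ ≠ 0 :=
  (ENNReal.ofReal_pos.2 (mul_pos (pow_pos hδ n) integral_radialBump_pos)).ne'

lemma bumpMass_ne_top {δ : ℝ} : bumpMass n δ ≠ ∞ := ENNReal.ofReal_ne_top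

lemma lintegral_radialBump_dilate {δ : ℝ} (hδ : 0 < δ) (x : E n) :
    ∫⁻ z, ENNReal.ofReal (radialBump (δ⁻¹ • (x - z))) = bumpMass n δ := by
  have h := integral_radialBump_smul (f := fun _ : E n => (1 : ℝ)) (x := x) hδ
    (fun z _ => harmonicAt_const 1)
  simp only [smul_eq_mul, mul_one, finrank_euclideanSpace, Fintype.card_fin] at h
  rw [bumpMass, ← h, ofReal_integral_eq_lintegral_ofReal]
  · by_contra hni
    rw [integral_undef hni] at h
    exact (mul_pos (pow_pos hδ n) integral_radialBump_pos).ne h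
  · exact Filter.Eventually.of_forall fun z => radialBump_nonneg _

lemma closedBall_subset_unitBall {x : E n} {δ : ℝ} (h : ‖x‖ + δ < 1) :
    closedBall x δ ⊆ ball 0 1 := by
  intro z hz
  have : ‖z - x‖ ≤ δ := by simpa [dist_eq_norm] using hz
  have := norm_le_norm_add_norm_sub' z x
  simp only [mem_ball, dist_zero_right]
  linarith

/-- The sub-mean value inequality for the modulus of a harmonic function. -/
lemma bumpMass_mul_enorm_le {f : E n → 𝕜} (hf : IsHarmonicOnBall f) {x : E n} {δ : ℝ} (hδ : 0 < δ)
    (hx : ‖x‖ + δ < 1) :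
    bumpMass n δ * ‖f x‖ₑ ≤ ∫⁻ z, ENNReal.ofReal (radialBump (δ⁻¹ • (x - z))) * ‖f z‖ₑ := by
  have h := integral_radialBump_smul (f := f) (x := x) hδ
    (fun z hz => hf z (closedBall_subset_unitBall hx hz))
  have h2 := enorm_integral_le_lintegral_enorm (μ := (volume : Measure (E n)))
    (fun z => radialBump (δ⁻¹ • (x - z)) • f z)
  rw [h, enorm_smul, Real.enorm_of_nonneg
    (mul_nonneg (by positivity) integral_radialBump_pos.le), finrank_euclideanSpace,
    Fintype.card_fin] at h2
  refine h2.trans (le_of_eq (lintegral_congr fun z => ?_))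
  rw [enorm_smul, Real.enorm_of_nonneg (radialBump_nonneg _)]

lemma radialBump_eq_norm (e : E n) (he : ‖e‖ = 1) (z : E n) :
    radialBump z = radialBump (‖z‖ • e) := by
  simp [radialBump, norm_smul, he]

/-- The integral means satisfy the sub-mean value inequality. -/
lemma bumpMass_mul_M1_le [NeZero n] {f : E n → 𝕜} (hf : IsHarmonicOnBall f) {e : E n}
    (he : ‖e‖ = 1) {ρ δ : ℝ} (hρ : 0 ≤ ρ) (hδ : 0 < δ) (hρδ : ρ + δ < 1) :
    bumpMass n δ * M1 f ρ ≤
      ∫⁻ z, ENNReal.ofReal (radialBump (δ⁻¹ • (ρ • e - z))) * M1 f ‖z‖ := by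
  set κ : ℝ → ℝ≥0∞ := fun t => ENNReal.ofReal (radialBump (δ⁻¹ • (t • e))) with hκdef
  have hκ : Measurable κ :=
    (ENNReal.continuous_ofReal.comp (continuous_radialBump.comp (by fun_prop))).measurable
  have hκz : ∀ z : E n, ENNReal.ofReal (radialBump (δ⁻¹ • z)) = κ ‖z‖ := fun z => by
    rw [hκdef, radialBump_eq_norm e he, norm_smul, mul_smul, norm_inv, Real.norm_of_nonneg hδ.le]
  have hκδ : ∀ t, δ < t → κ t = 0 := fun t ht => by
    rw [hκdef]
    simp only
    rw [radialBump_of_one_le, ENNReal.ofReal_zero]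
    rw [norm_smul, norm_smul, he, mul_one, norm_inv, Real.norm_of_nonneg hδ.le,
      Real.norm_of_nonneg (hδ.trans ht).le, inv_mul_eq_div, one_le_div hδ]
    exact ht.le
  have h := lintegral_sphereMeasure_convolution hκ (isHarmonicOnBall_continuousOn hf) he hρ hρδ hκδ
  simp_rw [hκz]
  rw [← h, M1, ← lintegral_const_mul']
  · refine lintegral_mono fun x => ?_
    simp_rw [← hκz]
    exact bumpMass_mul_enorm_le hf hδ (by simpa [norm_smul, abs_of_nonneg hρ] using hρδ)
  · exact bumpMass_ne_top

lemma M1_eq_ofReal {f : E n → 𝕜} (hf : ContinuousOn f (ball 0 1)) {r : ℝ} (hr : r ∈ Ico (0 : ℝ) 1) :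
    M1 f r = ENNReal.ofReal (∫ x : sphere (0 : E n) 1, ‖f (r • (x : E n))‖ ∂(sphereMeasure n)) := by
  have hc : Continuous fun x : sphere (0 : E n) 1 => f (r • (x : E n)) :=
    hf.comp_continuous (by fun_prop) fun x => smul_mem_unitBall hr x
  rw [M1, ofReal_integral_norm_eq_lintegral_enorm]
  exact hc.integrable_of_hasCompactSupport (HasCompactSupport.of_compactSpace _)

lemma M1_lt_top {f : E n → 𝕜} (hf : ContinuousOn f (ball 0 1)) {r : ℝ} (hr : r ∈ Ico (0 : ℝ) 1) :
    M1 f r < ∞ := by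
  rw [M1_eq_ofReal hf hr]; exact ENNReal.ofReal_lt_top

lemma continuousOn_M1 {f : E n → 𝕜} (hf : ContinuousOn f (ball 0 1)) :
    ContinuousOn (M1 f) (Ico 0 1) := by
  have h : ContinuousOn (fun r : ℝ => ∫ x : sphere (0 : E n) 1, ‖f (r • (x : E n))‖
      ∂(sphereMeasure n)) (Ico 0 1) := by
    intro r hr
    obtain ⟨R, hrR, hR1⟩ := exists_between hr.2
    have hR : ContinuousOn (fun r : ℝ => ∫ x : sphere (0 : E n) 1, ‖f (r • (x : E n))‖
        ∂(sphereMeasure n)) (Icc 0 R) := by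
      have hsub : ∀ s ∈ Icc 0 R, ∀ x : sphere (0 : E n) 1, s • (x : E n) ∈ closedBall (0 : E n) R :=
        fun s hs x => by simpa [norm_smul, abs_of_nonneg hs.1] using hs.2
      have hfR : ContinuousOn f (closedBall 0 R) := hf.mono (closedBall_subset_ball hR1)
      obtain ⟨C, hC⟩ := (isCompact_closedBall (0 : E n) R).exists_bound_of_continuousOn hfR
      refine continuousOn_of_dominated (bound := fun _ => C) (fun s hs => ?_) (fun s hs => ?_)
        (integrable_const C) ?_
      · exact (hfR.norm.comp_continuous (by fun_prop) fun x => hsub s hs x).aestronglyMeasurable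
      · refine Filter.Eventually.of_forall fun x => ?_
        simpa using hC _ (hsub s hs x)
      · refine Filter.Eventually.of_forall fun x => ?_
        exact hfR.norm.comp (by fun_prop) fun s hs => hsub s hs x
    refine (hR r ⟨hr.1, hrR.le⟩).mono_of_mem_nhdsWithin ?_
    filter_upwards [self_mem_nhdsWithin, mem_nhdsWithin_of_mem_nhds (Iio_mem_nhds hrR)] with s h1 h2
    exact ⟨h1.1, le_of_lt h2⟩
  exact (ENNReal.continuous_ofReal.comp_continuousOn h).congr fun r hr => M1_eq_ofReal hf hr

/-- The integral means of a harmonic function increase with the radius: by the sub-mean value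
inequality they obey the maximum principle. -/
theorem monotoneOn_M1 [NeZero n] {f : E n → 𝕜} (hf : IsHarmonicOnBall f) :
    MonotoneOn (M1 f) (Ico 0 1) := by
  intro a ha R hR haR
  have hfc := isHarmonicOnBall_continuousOn hf
  have hR0 : 0 ≤ R := hR.1
  have hsub : Icc 0 R ⊆ Ico (0 : ℝ) 1 := fun r hr => ⟨hr.1, hr.2.trans_lt hR.2⟩
  have hc : ContinuousOn (M1 f) (Icc 0 R) := (continuousOn_M1 hfc).mono hsub
  obtain ⟨r₀, hr₀, hmax⟩ := isCompact_Icc.exists_isMaxOn (nonempty_Icc.2 hR0) hc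
  set M := M1 f r₀ with hM
  have hM_top : M < ∞ := M1_lt_top hfc (hsub hr₀)
  -- the largest radius at which the maximum over `[0, R]` is attained
  have hcl : IsCompact (Icc 0 R ∩ M1 f ⁻¹' {M}) :=
    (isCompact_Icc).of_isClosed_subset (hc.preimage_isClosed_of_isClosed isClosed_Icc
      isClosed_singleton) inter_subset_left
  obtain ⟨s, ⟨hs, hsM⟩, hsmax⟩ := hcl.exists_isGreatest ⟨r₀, hr₀, rfl⟩
  have hsM : M1 f s = M := hsM
  rcases eq_or_lt_of_le hs.2 with rfl | hsR
  · rw [hsM]; exact hmax ⟨ha.1, haR⟩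
  exfalso
  obtain ⟨e, he⟩ := exists_norm_eq_one (n := n)
  have hδ : 0 < R - s := sub_pos.2 hsR
  have hle := bumpMass_mul_M1_le hf he hs.1 hδ (by linarith [hR.2])
  set k : E n → ℝ≥0∞ := fun z => ENNReal.ofReal (radialBump ((R - s)⁻¹ • (s • e - z))) with hk
  have hkm : Measurable k :=
    (ENNReal.continuous_ofReal.comp (continuous_radialBump.comp (by fun_prop))).measurable
  have hin : ∀ z : E n, ‖s • e - z‖ < R - s → ‖z‖ < R := by
    intro z hz
    have h1 := norm_sub_norm_le z (s • e)
    rw [norm_smul, he, mul_one, Real.norm_of_nonneg hs.1, norm_sub_rev] at h1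
    linarith
  have hscale : ∀ z : E n, ‖(R - s)⁻¹ • (s • e - z)‖ < 1 ↔ ‖s • e - z‖ < R - s := by
    intro z
    rw [norm_smul, norm_inv, Real.norm_of_nonneg hδ.le, inv_mul_eq_div, div_lt_one hδ]
  have hpt : ∀ z, k z * M1 f ‖z‖ ≤ k z * M := by
    intro z
    by_cases hz : ‖s • e - z‖ < R - s
    · exact mul_le_mul_right (hmax ⟨norm_nonneg z, (hin z hz).le⟩) _
    · have : k z = 0 := by
        rw [hk]
        simp only
        rw [radialBump_of_one_le (not_lt.1 (mt (hscale z).1 hz)), ENNReal.ofReal_zero]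
      simp [this]
  have hmass : ∫⁻ z, k z * M = bumpMass n (R - s) * M := by
    rw [lintegral_mul_const _ hkm, lintegral_radialBump_dilate hδ]
  have hlt : ∫⁻ z, k z * M1 f ‖z‖ < ∫⁻ z, k z * M := by
    refine lintegral_strict_mono_of_ae_le_of_ae_lt_on (hkm.mul_const _).aemeasurable ?_
      (Filter.Eventually.of_forall hpt) (s := {z | ‖s • e - z‖ < R - s ∧ s < ‖z‖}) ?_ ?_
    · refine ((lintegral_mono hpt).trans_lt ?_).ne
      rw [hmass]
      exact ENNReal.mul_lt_top bumpMass_ne_top.lt_top hM_top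
    · have hopen : IsOpen {z : E n | ‖s • e - z‖ < R - s ∧ s < ‖z‖} :=
        (isOpen_lt (f := fun z : E n => ‖s • e - z‖) (by fun_prop) continuous_const).and
          (isOpen_lt (g := fun z : E n => ‖z‖) continuous_const continuous_norm)
      refine hopen.measure_ne_zero volume ⟨((s + R) / 2) • e, ?_, ?_⟩
      · rw [← sub_smul, norm_smul, he, mul_one, Real.norm_eq_abs, abs_lt]
        constructor <;> linarith
      · rw [norm_smul, he, mul_one, Real.norm_of_nonneg (by linarith [hs.1])]
        linarith
    · refine Filter.Eventually.of_forall fun z hz => ?_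
      have hkpos : k z ≠ 0 :=
        (ENNReal.ofReal_pos.2 (radialBump_pos ((hscale z).2 hz.1))).ne'
      have hlt : M1 f ‖z‖ < M := lt_of_le_of_ne (hmax ⟨norm_nonneg z, (hin z hz.1).le⟩)
        fun h => not_le.2 hz.2 (hsmax ⟨⟨norm_nonneg z, (hin z hz.1).le⟩, h⟩)
      exact (ENNReal.mul_lt_mul_iff_right hkpos ENNReal.ofReal_ne_top).2 hlt
  rw [hmass] at hlt
  rw [hsM] at hle
  exact absurd (hle.trans_lt hlt) (lt_irrefl _)

end IntegralMeans

end HarmonicDist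

/-! ### The Euler operator and the reproducing formula -/

namespace HarmonicDist

open Metric Topology InnerProductSpace
open scoped Laplacian

section Euler

variable {V : Type*} [NormedAddCommGroup V] [InnerProductSpace ℝ V] [FiniteDimensional ℝ V]
  {W : Type*} [NormedAddCommGroup W] [NormedSpace ℝ W]

lemma laplacian_eq_sum_fderiv (f : V → W) (y : V) :
    Δ f y = ∑ i, fderiv ℝ (fderiv ℝ f) y (stdOrthonormalBasis ℝ V i)
      (stdOrthonormalBasis ℝ V i) := by
  rw [laplacian_eq_iteratedFDeriv_stdOrthonormalBasis]
  simp [iteratedFDeriv_two_apply]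

/-- The Euler operator `f ↦ ∑ᵢ zᵢ ∂ᵢf`, the radial derivative `|z| ∂f/∂|z|`. -/
def euler (f : V → W) (z : V) : W := fderiv ℝ f z z

/-- The Laplacian commutes with directional derivatives. -/
lemma sum_fderiv_fderiv_fderiv_eq_zero {f : V → W} {y : V} (hf : ContDiffAt ℝ 3 f y)
    (h : Δ f =ᶠ[𝓝 y] 0) (w : V) :
    ∑ i, fderiv ℝ (fderiv ℝ (fderiv ℝ f)) y (stdOrthonormalBasis ℝ V i) w
      (stdOrthonormalBasis ℝ V i) = 0 := by
  set b := stdOrthonormalBasis ℝ V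
  have hg : ContDiffAt ℝ 2 (fderiv ℝ f) y := hf.fderiv_right (by norm_num)
  have hH : DifferentiableAt ℝ (fderiv ℝ (fderiv ℝ f)) y :=
    (hg.fderiv_right (m := 1) (by norm_num)).differentiableAt (by norm_num)
  have hderiv : ∀ u v : V, HasFDerivAt (fun z => fderiv ℝ (fderiv ℝ f) z u v)
      ((fderiv ℝ (fderiv ℝ (fderiv ℝ f)) y).flip u |>.flip v) y := by
    intro u v
    have := (hH.hasFDerivAt.clm_apply (hasFDerivAt_const u y)).clm_apply (hasFDerivAt_const v y)
    refine this.congr_fderiv ?_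
    ext t
    simp
  -- the second derivative of `fderiv ℝ f` is symmetric
  have hsymm : ∀ u v t : V, fderiv ℝ (fderiv ℝ (fderiv ℝ f)) y u v t =
      fderiv ℝ (fderiv ℝ (fderiv ℝ f)) y v u t := fun u v t => by
    rw [(hg.isSymmSndFDerivAt (by simp)).eq u v]
  have hsum : HasFDerivAt (fun z => ∑ i, fderiv ℝ (fderiv ℝ f) z (b i) (b i))
      (∑ i, ((fderiv ℝ (fderiv ℝ (fderiv ℝ f)) y).flip (b i) |>.flip (b i))) y :=
    HasFDerivAt.fun_sum fun i _ => hderiv (b i) (b i)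
  have h0 : HasFDerivAt (fun z => ∑ i, fderiv ℝ (fderiv ℝ f) z (b i) (b i))
      (0 : V →L[ℝ] W) y := by
    refine (hasFDerivAt_const (0 : W) y).congr_of_eventuallyEq ?_
    filter_upwards [h] with z hz
    rw [← laplacian_eq_sum_fderiv, hz, Pi.zero_apply]
  have := congrArg (fun φ => φ w) (hsum.unique h0)
  simp only [sum_apply, ContinuousLinearMap.flip_apply, zero_apply] at this
  rw [← this]
  exact Finset.sum_congr rfl fun i _ => by rw [hsymm (b i) w (b i)]

variable [MeasurableSpace V] [BorelSpace V] [CompleteSpace W]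

/-- The Euler operator preserves harmonicity. -/
theorem harmonicAt_euler {f : V → W} {x : V} (hf : HarmonicAt f x) : HarmonicAt (euler f) x := by
  set b := stdOrthonormalBasis ℝ V
  -- `Δ (N f) = N (Δ f) + 2 Δ f`
  have key : ∀ y, HarmonicAt f y → Δ (euler f) y = 0 := by
    intro y hy
    have hsm : ContDiffAt ℝ 3 f y := by
      exact_mod_cast contDiffAt_infty.1 hy.contDiffAt_infty 3
    have hg : ContDiffAt ℝ 2 (fderiv ℝ f) y := hsm.fderiv_right (by norm_num)
    have hH : DifferentiableAt ℝ (fderiv ℝ (fderiv ℝ f)) y :=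
      (hg.fderiv_right (m := 1) (by norm_num)).differentiableAt (by norm_num)
    have h1 : fderiv ℝ (euler f) =ᶠ[𝓝 y]
        fun z => fderiv ℝ (fderiv ℝ f) z z + fderiv ℝ f z := by
      filter_upwards [hsm.eventually (by simp)] with z hz
      have hgz : DifferentiableAt ℝ (fderiv ℝ f) z :=
        (hz.fderiv_right (m := 1) (by norm_num)).differentiableAt (by norm_num)
      have := (hgz.hasFDerivAt.clm_apply (hasFDerivAt_id z)).fderiv
      ext v
      change fderiv ℝ (fun z => fderiv ℝ f z z) z v = _
      simp only [id] at this
      rw [this]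
      simp [add_comm, (hz.isSymmSndFDerivAt (by simp; norm_num)).eq v z]
    have hd : HasFDerivAt (fun z => fderiv ℝ (fderiv ℝ f) z z + fderiv ℝ f z)
        ((fderiv ℝ (fderiv ℝ (fderiv ℝ f)) y).flip y + fderiv ℝ (fderiv ℝ f) y
          + fderiv ℝ (fderiv ℝ f) y) y := by
      have h3 := (hH.hasFDerivAt.clm_apply (hasFDerivAt_id y)).add
        (hg.differentiableAt (by norm_num)).hasFDerivAt
      refine h3.congr_fderiv ?_
      ext u v
      simp [add_comm]
    rw [laplacian_eq_sum_fderiv, h1.fderiv_eq, hd.fderiv]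
    have hlap := hy.2.self_of_nhds
    rw [laplacian_eq_sum_fderiv] at hlap
    have h3 := sum_fderiv_fderiv_fderiv_eq_zero hsm hy.2 y
    simp only [Pi.zero_apply] at hlap
    simp [Finset.sum_add_distrib, hlap, h3]
  refine ⟨?_, ?_⟩
  · have hsm : ContDiffAt ℝ 3 f x := by
      exact_mod_cast contDiffAt_infty.1 hf.contDiffAt_infty 3
    exact (hsm.fderiv_right (m := 2) (by norm_num)).clm_apply contDiffAt_id
  · filter_upwards [hf.eventually] with y hy using key y hy

/-- The operator `(N + 1)(N + 2)⋯(N + j)`, where `N` is the Euler operator. -/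
def radialDeriv : ℕ → (V → W) → V → W
  | 0, f => f
  | j + 1, f => euler (radialDeriv j f) + ((j : ℝ) + 1) • radialDeriv j f

lemma harmonicAt_radialDeriv (j : ℕ) {f : V → W} {x : V} (hf : HarmonicAt f x) :
    HarmonicAt (radialDeriv j f) x := by
  induction j with
  | zero => exact hf
  | succ j ih => exact (harmonicAt_euler ih).add ih.const_smul

end Euler

section Reproducing

variable {V : Type*} [NormedAddCommGroup V] [InnerProductSpace ℝ V] [FiniteDimensional ℝ V]
  [MeasurableSpace V] [BorelSpace V]
  {W : Type*} [NormedAddCommGroup W] [NormedSpace ℝ W] [CompleteSpace W]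

lemma sq_smul_mem_unitBall {x : V} (hx : x ∈ ball (0 : V) 1) {r : ℝ} (hr : r ∈ Icc (0 : ℝ) 1) :
    r ^ 2 • x ∈ ball (0 : V) 1 := by
  have hx : ‖x‖ < 1 := by simpa using hx
  have : r ^ 2 ≤ 1 := pow_le_one₀ hr.1 hr.2
  simp only [mem_ball, dist_zero_right, norm_smul, norm_pow, Real.norm_of_nonneg hr.1]
  nlinarith [norm_nonneg x]

lemma continuousOn_comp_sq_smul {f : V → W} (hf : ContinuousOn f (ball 0 1)) {x : V}
    (hx : x ∈ ball (0 : V) 1) : ContinuousOn (fun r : ℝ => f (r ^ 2 • x)) (Icc 0 1) :=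
  hf.comp (by fun_prop) fun _ hr => sq_smul_mem_unitBall hx hr

/-- Integration by parts along a ray: the derivative of `(1 - r²)ᵏ r² g(r² x)` vanishes in the mean
if `k > 0`. For `k = 0` the boundary term `g x` survives, and the truncated exponent `k - 1` is
harmless because of the factor `k`. -/
lemma integral_weight_smul_euler {g : V → W} (hg : ∀ z ∈ ball (0 : V) 1, HarmonicAt g z)
    {x : V} (hx : x ∈ ball (0 : V) 1) (k : ℕ) :
    ∫ r in (0 : ℝ)..1, (2 * r * (1 - r ^ 2) ^ k) •
        (euler g + ((k : ℝ) + 1) • g) (r ^ 2 • x) =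
      (0 : ℝ) ^ k • g x +
        (k : ℝ) • ∫ r in (0 : ℝ)..1, (2 * r * (1 - r ^ 2) ^ (k - 1)) • g (r ^ 2 • x) := by
  have hgc : ContinuousOn g (ball 0 1) := fun z hz => (hg z hz).1.continuousAt.continuousWithinAt
  have hec : ContinuousOn (euler g) (ball 0 1) := fun z hz =>
    (harmonicAt_euler (hg z hz)).1.continuousAt.continuousWithinAt
  have hc1 : ContinuousOn (fun r : ℝ => (2 * r * (1 - r ^ 2) ^ k) •
        (euler g + ((k : ℝ) + 1) • g) (r ^ 2 • x)) (uIcc 0 1) := by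
    rw [uIcc_of_le zero_le_one]
    exact (Continuous.continuousOn (by fun_prop)).smul ((continuousOn_comp_sq_smul hec hx).add
      (continuousOn_const.smul (continuousOn_comp_sq_smul hgc hx)))
  have hc2 : ContinuousOn (fun r : ℝ => (k : ℝ) • (2 * r * (1 - r ^ 2) ^ (k - 1)) •
        g (r ^ 2 • x)) (uIcc 0 1) := by
    rw [uIcc_of_le zero_le_one]
    exact continuousOn_const.smul ((Continuous.continuousOn (by fun_prop)).smul
      (continuousOn_comp_sq_smul hgc hx))
  have hderiv : ∀ r ∈ uIcc (0 : ℝ) 1, HasDerivAt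
      (fun r : ℝ => ((1 - r ^ 2) ^ k * r ^ 2) • g (r ^ 2 • x))
      ((2 * r * (1 - r ^ 2) ^ k) • (euler g + ((k : ℝ) + 1) • g) (r ^ 2 • x) -
        (k : ℝ) • (2 * r * (1 - r ^ 2) ^ (k - 1)) • g (r ^ 2 • x)) r := by
    intro r hr
    rw [uIcc_of_le zero_le_one] at hr
    have h1 : HasDerivAt (fun r : ℝ => r ^ 2 • x) ((2 * r) • x) r := by
      simpa using (hasDerivAt_pow 2 r).smul_const x
    have h2 := ((hg _ (sq_smul_mem_unitBall hx hr)).1.differentiableAt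
      (by norm_num)).hasFDerivAt.comp_hasDerivAt r h1
    have h3 : HasDerivAt (fun r : ℝ => (1 - r ^ 2) ^ k * r ^ 2)
        ((k * (1 - r ^ 2) ^ (k - 1) * (-(2 * r))) * r ^ 2 + (1 - r ^ 2) ^ k * (2 * r)) r := by
      have h4 : HasDerivAt (fun r : ℝ => 1 - r ^ 2) (-(2 * r)) r := by
        simpa using (hasDerivAt_pow 2 r).const_sub 1
      exact ((h4.fun_pow k).fun_mul (hasDerivAt_pow 2 r)).congr_deriv (by simp)
    refine (h3.smul h2).congr_deriv ?_
    simp only [Pi.add_apply, Pi.smul_apply, euler, Function.comp_apply, map_smul, smul_add,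
      smul_smul]
    have e1 : (k : ℝ) * (1 - r ^ 2) ^ (k - 1) * (-(2 * r)) * r ^ 2 + (1 - r ^ 2) ^ k * (2 * r) =
        2 * r * (1 - r ^ 2) ^ k * ((k : ℝ) + 1) - (k : ℝ) * (2 * r * (1 - r ^ 2) ^ (k - 1)) := by
      rcases k with _ | k
      · simp
      · simp only [Nat.add_sub_cancel, pow_succ]
        push_cast
        ring
    rw [e1, sub_smul, add_sub_assoc]
    congr 2
    ring
  have hint := intervalIntegral.integral_eq_sub_of_hasDerivAt hderiv
    (hc1.sub hc2).intervalIntegrable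
  rw [intervalIntegral.integral_sub hc1.intervalIntegrable hc2.intervalIntegrable,
    intervalIntegral.integral_smul, sub_eq_iff_eq_add] at hint
  rw [hint]
  simp

/-- The reproducing formula: `radialDeriv (m + 1)` is inverted by integrating along rays. -/
theorem integral_radialDeriv_eq {f : V → W} (hf : ∀ z ∈ ball (0 : V) 1, HarmonicAt f z)
    {x : V} (hx : x ∈ ball (0 : V) 1) (m : ℕ) :
    ∫ r in (0 : ℝ)..1, (2 * r * (1 - r ^ 2) ^ m) • radialDeriv (m + 1) f (r ^ 2 • x) =
      (m.factorial : ℝ) • f x := by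
  induction m with
  | zero =>
    have := integral_weight_smul_euler hf hx 0
    simpa [radialDeriv] using this
  | succ m ih =>
    have := integral_weight_smul_euler (g := radialDeriv (m + 1) f)
      (fun z hz => harmonicAt_radialDeriv _ (hf z hz)) hx (m + 1)
    rw [Nat.add_sub_cancel, ih, zero_pow (Nat.succ_ne_zero m), zero_smul, zero_add, smul_smul] at this
    rw [Nat.factorial_succ, Nat.cast_mul, ← this]
    rfl

end Reproducing

end HarmonicDist

/-! ### Gradient estimates in the mean -/

namespace HarmonicDist

open Metric Topology InnerProductSpace

section Gradient

variable {n : ℕ} {𝕜 : Type*} [RCLike 𝕜]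

/-- The indicator of `[0, d]`, used as the profile of a radial kernel. -/
def ballProfile (d : ℝ) : ℝ → ℝ≥0∞ := (Iic d).indicator 1

lemma measurable_ballProfile (d : ℝ) : Measurable (ballProfile d) :=
  measurable_one.indicator measurableSet_Iic

lemma lintegral_ballProfile_mul (d : ℝ) (x : E n) (F : E n → ℝ≥0∞) :
    ∫⁻ z, ballProfile d ‖x - z‖ * F z = ∫⁻ z in closedBall x d, F z := by
  rw [← lintegral_indicator isClosed_closedBall.measurableSet]
  refine lintegral_congr fun z => ?_
  by_cases hz : z ∈ closedBall x d
  · have : ‖x - z‖ ≤ d := by rwa [← dist_eq_norm, dist_comm]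
    rw [indicator_of_mem hz, ballProfile, indicator_of_mem (mem_Iic.2 this), Pi.one_apply, one_mul]
  · have : ¬ ‖x - z‖ ≤ d := by rwa [← dist_eq_norm, dist_comm]
    rw [indicator_of_notMem hz, ballProfile, indicator_of_notMem (by simpa using this), zero_mul]

/-- The gradient estimate for harmonic functions, obtained by moving the centre of a Lipschitz
mean value kernel. -/
lemma bumpMass_mul_enorm_fderiv_le {L : ℝ≥0} (hL : LipschitzWith L (radialBump : E n → ℝ))
    {f : E n → 𝕜} (hf : IsHarmonicOnBall f) {x : E n} {δ : ℝ} (hδ : 0 < δ)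
    (hx : ‖x‖ + 2 * δ < 1) :
    bumpMass n δ * ‖fderiv ℝ f x‖ₑ ≤
      ENNReal.ofReal (L / δ) * ∫⁻ z, ballProfile (2 * δ) ‖x - z‖ * ‖f z‖ₑ := by
  set c : ℝ := δ ^ n * ∫ z : E n, radialBump z with hc
  have hc0 : 0 < c := mul_pos (by positivity) integral_radialBump_pos
  have hcont : ContinuousOn f (closedBall x (2 * δ)) :=
    (isHarmonicOnBall_continuousOn hf).mono (closedBall_subset_unitBall hx)
  have hfint : IntegrableOn f (closedBall x (2 * δ)) :=
    hcont.integrableOn_compact (isCompact_closedBall _ _)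
  set A : ℝ := ∫ z in closedBall x (2 * δ), ‖f z‖ with hA
  have hA0 : 0 ≤ A := integral_nonneg fun _ => norm_nonneg _
  have hsupp : ∀ y ∈ ball x δ, ∀ z ∉ closedBall x (2 * δ), radialBump (δ⁻¹ • (y - z)) = 0 := by
    intro y hy z hz
    have hy : dist y x < δ := hy
    have hz : 2 * δ < dist z x := by simpa using hz
    apply radialBump_of_one_le
    rw [norm_smul, norm_inv, Real.norm_of_nonneg hδ.le, inv_mul_eq_div, one_le_div hδ,
      ← dist_eq_norm, dist_comm]
    linarith [dist_triangle z y x]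
  have hint : ∀ y ∈ ball x δ, IntegrableOn (fun z => radialBump (δ⁻¹ • (y - z)) • f z)
      (closedBall x (2 * δ)) := fun y _ =>
    ((continuous_radialBump.comp (by fun_prop)).continuousOn.smul hcont).integrableOn_compact
      (isCompact_closedBall _ _)
  have hmv : ∀ y ∈ ball x δ,
      ∫ z in closedBall x (2 * δ), radialBump (δ⁻¹ • (y - z)) • f z = c • f y := by
    intro y hy
    have hy' : ‖y‖ + δ < 1 := by
      have : ‖y - x‖ < δ := by simpa [dist_eq_norm] using hy
      have := norm_le_norm_add_norm_sub' y x
      linarith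
    have h := integral_radialBump_smul (f := f) (x := y) hδ
      (fun z hz => hf z (closedBall_subset_unitBall hy' hz))
    rw [finrank_euclideanSpace, Fintype.card_fin] at h
    rw [← h]
    refine setIntegral_eq_integral_of_forall_compl_eq_zero fun z hz => ?_
    rw [hsupp y hy z hz, zero_smul]
  have hxx : x ∈ ball x δ := mem_ball_self hδ
  have hlip : ∀ y ∈ ball x δ, ‖f y - f x‖ ≤ c⁻¹ * (L / δ * A) * ‖y - x‖ := by
    intro y hy
    have h1 : c • (f y - f x) = ∫ z in closedBall x (2 * δ),
        (radialBump (δ⁻¹ • (y - z)) - radialBump (δ⁻¹ • (x - z))) • f z := by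
      simp_rw [sub_smul]
      rw [integral_sub (hint y hy) (hint x hxx), hmv y hy, hmv x hxx, smul_sub]
    have h2 : ‖c • (f y - f x)‖ ≤ ∫ z in closedBall x (2 * δ), L / δ * ‖y - x‖ * ‖f z‖ := by
      rw [h1]
      refine norm_integral_le_of_norm_le (hfint.norm.const_mul _) ?_
      refine Filter.Eventually.of_forall fun z => ?_
      rw [norm_smul]
      refine mul_le_mul_of_nonneg_right ?_ (norm_nonneg _)
      have := hL.norm_sub_le (δ⁻¹ • (y - z)) (δ⁻¹ • (x - z))
      rw [← smul_sub, sub_sub_sub_cancel_right, norm_smul, norm_inv,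
        Real.norm_of_nonneg hδ.le] at this
      refine this.trans (le_of_eq ?_)
      ring
    rw [integral_const_mul, norm_smul, Real.norm_of_nonneg hc0.le, ← hA] at h2
    rw [mul_assoc, ← div_eq_inv_mul, div_mul_eq_mul_div, le_div_iff₀ hc0]
    refine (mul_comm _ _).trans_le (h2.trans (le_of_eq ?_))
    ring
  have hfd : ‖fderiv ℝ f x‖ ≤ c⁻¹ * (L / δ * A) :=
    norm_fderiv_le_of_lip' ℝ (by positivity)
      (Filter.mem_of_superset (ball_mem_nhds x hδ) hlip)
  have hfd' : c * ‖fderiv ℝ f x‖ ≤ L / δ * A := by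
    rwa [← div_eq_inv_mul, le_div_iff₀ hc0, mul_comm] at hfd
  rw [lintegral_ballProfile_mul, ← ofReal_integral_norm_eq_lintegral_enorm hfint,
    ← ENNReal.ofReal_mul (by positivity), bumpMass, ← ofReal_norm,
    ← ENNReal.ofReal_mul hc0.le]
  exact ENNReal.ofReal_le_ofReal hfd'

/-- Integral means of the gradient are controlled by integral means of the function on a larger
sphere. -/
lemma exists_lintegral_enorm_fderiv_le (n : ℕ) [NeZero n] (𝕜 : Type*) [RCLike 𝕜] :
    ∃ K : ℝ, 0 ≤ K ∧ ∀ f : E n → 𝕜, IsHarmonicOnBall f → ∀ s δ : ℝ, 0 ≤ s → 0 < δ → s + 2 * δ < 1 →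
      ∫⁻ x : sphere (0 : E n) 1, ‖fderiv ℝ f (s • (x : E n))‖ₑ ∂(sphereMeasure n) ≤
        ENNReal.ofReal (K / δ) * M1 f (s + 2 * δ) := by
  obtain ⟨L, hL⟩ := ContDiff.lipschitzWith_of_hasCompactSupport
    (hasCompactSupport_radialBump (V := E n)) (contDiff_radialBump (V := E n)) (by simp)
  set I : ℝ := ∫ z : E n, radialBump z with hI
  have hI0 : 0 < I := integral_radialBump_pos
  set v : ℝ := volume.real (ball (0 : E n) 1) with hv
  have hv0 : 0 ≤ v := measureReal_nonneg
  refine ⟨L * 2 ^ n * v / I, by positivity, fun f hf s δ hs hδ hsδ => ?_⟩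
  obtain ⟨e, he⟩ := exists_norm_eq_one (n := n)
  have hpt : ∀ x : sphere (0 : E n) 1, bumpMass n δ * ‖fderiv ℝ f (s • (x : E n))‖ₑ ≤
      ENNReal.ofReal (L / δ) * ∫⁻ z, ballProfile (2 * δ) ‖s • (x : E n) - z‖ * ‖f z‖ₑ := fun x =>
    bumpMass_mul_enorm_fderiv_le hL hf hδ (by simpa [norm_smul, abs_of_nonneg hs] using hsδ)
  have hconv := lintegral_sphereMeasure_convolution (measurable_ballProfile (2 * δ))
    (isHarmonicOnBall_continuousOn hf) he hs hsδ (fun t ht => by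
      rw [ballProfile, indicator_of_notMem (by simpa using ht)])
  have hbound : ∫⁻ z, ballProfile (2 * δ) ‖s • e - z‖ * M1 f ‖z‖ ≤
      ENNReal.ofReal ((2 * δ) ^ n * v) * M1 f (s + 2 * δ) := by
    rw [lintegral_ballProfile_mul (F := fun z => M1 f ‖z‖)]
    have : ∀ z ∈ closedBall (s • e) (2 * δ), M1 f ‖z‖ ≤ M1 f (s + 2 * δ) := by
      intro z hz
      have hz' : ‖z‖ ≤ s + 2 * δ := by
        have h1 := norm_le_norm_add_norm_sub' z (s • e)
        have h2 : ‖z - s • e‖ ≤ 2 * δ := by simpa [dist_eq_norm] using hz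
        rw [norm_smul, he, mul_one, Real.norm_of_nonneg hs] at h1
        linarith
      exact monotoneOn_M1 hf ⟨norm_nonneg z, hz'.trans_lt hsδ⟩ ⟨by positivity, hsδ⟩ hz'
    refine (setLIntegral_mono' isClosed_closedBall.measurableSet this).trans ?_
    rw [setLIntegral_const, mul_comm]
    refine mul_le_mul_left (le_of_eq ?_) _
    rw [Measure.addHaar_closedBall _ _ (by positivity), finrank_euclideanSpace, Fintype.card_fin,
      ENNReal.ofReal_mul (by positivity), hv, ofReal_measureReal (measure_ball_lt_top.ne)]
  have hmul : bumpMass n δ *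
      ∫⁻ x : sphere (0 : E n) 1, ‖fderiv ℝ f (s • (x : E n))‖ₑ ∂(sphereMeasure n) ≤
      bumpMass n δ * (ENNReal.ofReal (L * 2 ^ n * v / I / δ) * M1 f (s + 2 * δ)) := by
    rw [← lintegral_const_mul' _ _ bumpMass_ne_top]
    refine (lintegral_mono hpt).trans ?_
    rw [lintegral_const_mul' _ _ ENNReal.ofReal_ne_top, hconv]
    refine (mul_le_mul_right hbound _).trans (le_of_eq ?_)
    rw [← mul_assoc, ← mul_assoc, bumpMass, ← ENNReal.ofReal_mul (by positivity),
      ← ENNReal.ofReal_mul (by positivity)]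
    congr 2
    rw [← hI, mul_pow]
    field_simp
  exact (ENNReal.mul_le_mul_iff_right (bumpMass_ne_zero hδ) bumpMass_ne_top).1 hmul

lemma M1_add_le {f g : E n → 𝕜} (hf : ContinuousOn f (ball 0 1)) {r : ℝ}
    (hr : r ∈ Ico (0 : ℝ) 1) : M1 (f + g) r ≤ M1 f r + M1 g r := by
  have hc : Continuous fun x : sphere (0 : E n) 1 => f (r • (x : E n)) :=
    hf.comp_continuous (by fun_prop) fun x => smul_mem_unitBall hr x
  rw [M1, M1, M1, ← lintegral_add_left (hc.enorm.measurable)]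
  exact lintegral_mono fun x => enorm_add_le _ _

lemma M1_const_smul (c : ℝ) (f : E n → 𝕜) (r : ℝ) : M1 (c • f) r = ‖c‖ₑ * M1 f r := by
  rw [M1, M1, ← lintegral_const_mul' _ _ (by simp)]
  exact lintegral_congr fun x => by rw [Pi.smul_apply, enorm_smul]

lemma isHarmonicOnBall_euler {f : E n → 𝕜} (hf : IsHarmonicOnBall f) :
    IsHarmonicOnBall (euler f) := fun z hz => harmonicAt_euler (hf z hz)

lemma isHarmonicOnBall_radialDeriv (j : ℕ) {f : E n → 𝕜} (hf : IsHarmonicOnBall f) :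
    IsHarmonicOnBall (radialDeriv j f) := fun z hz => harmonicAt_radialDeriv j (hf z hz)

/-- The Euler derivative costs one power of the distance to the boundary. The factor `‖x‖` in its
definition makes the estimate uniform in the outer radius `r`, also as `r → 0`. -/
lemma exists_M1_euler_le (n : ℕ) [NeZero n] (𝕜 : Type*) [RCLike 𝕜] :
    ∃ K : ℝ, 0 ≤ K ∧ ∀ f : E n → 𝕜, IsHarmonicOnBall f → ∀ r ∈ Ico (0 : ℝ) 1, ∀ ρ ∈ Ico (0 : ℝ) 1,
      M1 (euler f) (r * ρ) ≤ ENNReal.ofReal (K / (1 - ρ)) * M1 f (r * ((1 + ρ) / 2)) := by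
  obtain ⟨K, hK0, hK⟩ := exists_lintegral_enorm_fderiv_le n 𝕜
  refine ⟨4 * K, by positivity, fun f hf r hr ρ hρ => ?_⟩
  have hρ1 : 0 < 1 - ρ := sub_pos.2 hρ.2
  rcases eq_or_lt_of_le hr.1 with rfl | hr0
  · simp [M1, euler]
  -- this choice makes `rρ + 2δ` the radius halfway between `rρ` and `r`
  set δ := r * (1 - ρ) / 4 with hδ
  have hδ0 : 0 < δ := by positivity
  have hsum : r * ρ + 2 * δ = r * ((1 + ρ) / 2) := by rw [hδ]; ring
  have h := hK f hf (r * ρ) δ (mul_nonneg hr.1 hρ.1) hδ0 (by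
    rw [hsum]; nlinarith [hr.1, hr.2, hρ.1, hρ.2])
  rw [hsum] at h
  have hpt : ∀ x : sphere (0 : E n) 1, ‖euler f ((r * ρ) • (x : E n))‖ₑ ≤
      ENNReal.ofReal r * ‖fderiv ℝ f ((r * ρ) • (x : E n))‖ₑ := by
    intro x
    refine (ContinuousLinearMap.le_opENorm _ _).trans ?_
    rw [mul_comm]
    refine mul_le_mul_left ?_ _
    rw [← ofReal_norm, norm_smul, norm_eq_of_mem_sphere, mul_one,
      Real.norm_of_nonneg (mul_nonneg hr.1 hρ.1)]
    exact ENNReal.ofReal_le_ofReal (mul_le_of_le_one_right hr.1 hρ.2.le)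
  calc M1 (euler f) (r * ρ) ≤ ∫⁻ x : sphere (0 : E n) 1,
        ENNReal.ofReal r * ‖fderiv ℝ f ((r * ρ) • (x : E n))‖ₑ ∂(sphereMeasure n) :=
        lintegral_mono hpt
    _ = ENNReal.ofReal r * ∫⁻ x : sphere (0 : E n) 1,
        ‖fderiv ℝ f ((r * ρ) • (x : E n))‖ₑ ∂(sphereMeasure n) :=
        lintegral_const_mul' _ _ ENNReal.ofReal_ne_top
    _ ≤ ENNReal.ofReal r * (ENNReal.ofReal (K / δ) * M1 f (r * ((1 + ρ) / 2))) :=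
        mul_le_mul_right h _
    _ = ENNReal.ofReal (4 * K / (1 - ρ)) * M1 f (r * ((1 + ρ) / 2)) := by
        rw [← mul_assoc, ← ENNReal.ofReal_mul hr.1]
        congr 2
        rw [hδ]
        field_simp

/-- Each application of a radial derivative costs one power of the distance to the boundary. -/
theorem exists_M1_radialDeriv_le (n : ℕ) [NeZero n] (𝕜 : Type*) [RCLike 𝕜] (j : ℕ) :
    ∃ K : ℝ, 0 ≤ K ∧ ∀ f : E n → 𝕜, IsHarmonicOnBall f → ∀ r ∈ Ico (0 : ℝ) 1, ∀ ρ ∈ Ico (0 : ℝ) 1,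
      M1 (radialDeriv j f) (r * ρ) ≤ ENNReal.ofReal (K / (1 - ρ) ^ j) * M1 f r := by
  obtain ⟨K', hK'0, hK'⟩ := exists_M1_euler_le n 𝕜
  have hmem : ∀ r ∈ Ico (0 : ℝ) 1, ∀ ρ ∈ Icc (0 : ℝ) 1, r * ρ ∈ Ico (0 : ℝ) 1 := fun r hr ρ hρ =>
    ⟨mul_nonneg hr.1 hρ.1, (mul_le_of_le_one_right hr.1 hρ.2).trans_lt hr.2⟩
  induction j with
  | zero =>
    refine ⟨1, zero_le_one, fun f hf r hr ρ hρ => ?_⟩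
    simp only [pow_zero, div_one, ENNReal.ofReal_one, one_mul]
    exact monotoneOn_M1 hf (hmem r hr ρ ⟨hρ.1, hρ.2.le⟩) hr (mul_le_of_le_one_right hr.1 hρ.2.le)
  | succ j ih =>
    obtain ⟨K, hK0, hK⟩ := ih
    refine ⟨(K' + (j + 1)) * (K * 2 ^ j), by positivity, fun f hf r hr ρ hρ => ?_⟩
    have hρ1 : 0 < 1 - ρ := sub_pos.2 hρ.2
    set g := radialDeriv j f with hg
    have hgh : IsHarmonicOnBall g := isHarmonicOnBall_radialDeriv j hf
    set ρ' := (1 + ρ) / 2 with hρ'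
    have hρ'mem : ρ' ∈ Ico (0 : ℝ) 1 := ⟨by linarith [hρ.1], by linarith [hρ.2]⟩
    have hmono : M1 g (r * ρ) ≤ M1 g (r * ρ') :=
      monotoneOn_M1 hgh (hmem r hr ρ ⟨hρ.1, hρ.2.le⟩) (hmem r hr ρ' ⟨hρ'mem.1, hρ'mem.2.le⟩)
        (mul_le_mul_of_nonneg_left (by linarith [hρ.2]) hr.1)
    calc M1 (radialDeriv (j + 1) f) (r * ρ)
        ≤ M1 (euler g) (r * ρ) + M1 (((j : ℝ) + 1) • g) (r * ρ) :=
          M1_add_le (isHarmonicOnBall_continuousOn (isHarmonicOnBall_euler hgh))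
            (hmem r hr ρ ⟨hρ.1, hρ.2.le⟩)
      _ ≤ ENNReal.ofReal (K' / (1 - ρ)) * M1 g (r * ρ') +
          ENNReal.ofReal ((j + 1) / (1 - ρ)) * M1 g (r * ρ') := by
          refine add_le_add (hK' g hgh r hr ρ hρ) ?_
          rw [M1_const_smul]
          refine mul_le_mul' ?_ hmono
          rw [Real.enorm_of_nonneg (by positivity)]
          refine ENNReal.ofReal_le_ofReal ?_
          rw [le_div_iff₀ hρ1]
          exact mul_le_of_le_one_right (by positivity) (by linarith [hρ.1])
      _ = ENNReal.ofReal ((K' + (j + 1)) / (1 - ρ)) * M1 g (r * ρ') := by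
          rw [← add_mul, ← ENNReal.ofReal_add (by positivity) (by positivity), ← add_div]
      _ ≤ ENNReal.ofReal ((K' + (j + 1)) / (1 - ρ)) *
          (ENNReal.ofReal (K / (1 - ρ') ^ j) * M1 f r) :=
          mul_le_mul_right (hK f hf r hr ρ' hρ'mem) _
      _ = ENNReal.ofReal ((K' + (j + 1)) * (K * 2 ^ j) / (1 - ρ) ^ (j + 1)) * M1 f r := by
          rw [← mul_assoc, ← ENNReal.ofReal_mul (by positivity)]
          congr 2
          have : 1 - ρ' = (1 - ρ) / 2 := by rw [hρ']; ring
          rw [this, div_pow, pow_succ]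
          field_simp

end Gradient

end HarmonicDist

/-! ### One-dimensional inequalities -/

namespace HarmonicDist

section OneDimensional

lemma lintegral_one_sub_rpow {a b c : ℝ} (hab : a ≤ b) (hc : -1 < c ∨ c ≠ -1 ∧ b < 1) (hb : b ≤ 1) :
    ∫⁻ r in Ioo a b, ENNReal.ofReal ((1 - r) ^ c) =
      ENNReal.ofReal (((1 - a) ^ (c + 1) - (1 - b) ^ (c + 1)) / (c + 1)) := by
  have hc' : -1 < c ∨ c ≠ -1 ∧ (0 : ℝ) ∉ uIcc (1 - b) (1 - a) := by
    refine hc.imp id fun h => ⟨h.1, fun h0 => ?_⟩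
    rw [uIcc_of_le (by linarith)] at h0
    linarith [h0.1, h.2]
  have hint : IntervalIntegrable (fun r : ℝ => (1 - r) ^ c) volume a b := by
    have h : IntervalIntegrable (fun u : ℝ => u ^ c) volume (1 - a) (1 - b) := by
      rcases hc' with h | h
      · exact intervalIntegral.intervalIntegrable_rpow' h
      · exact intervalIntegral.intervalIntegrable_rpow (Or.inr (by rw [uIcc_comm]; exact h.2))
    simpa using h.comp_sub_left 1
  have hint2 : IntegrableOn (fun r : ℝ => (1 - r) ^ c) (Ioo a b) :=
    (intervalIntegrable_iff_integrableOn_Ioo_of_le hab).1 hint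
  rw [← ofReal_integral_eq_lintegral_ofReal hint2]
  · rw [← integral_Ioc_eq_integral_Ioo, ← intervalIntegral.integral_of_le hab,
      intervalIntegral.integral_comp_sub_left (fun u : ℝ => u ^ c) 1, integral_rpow hc']
  · filter_upwards [ae_restrict_mem measurableSet_Ioo] with r hr
    exact Real.rpow_nonneg (by linarith [hr.2]) _

/-- The one-dimensional Forelli–Rudin estimate. -/
theorem lintegral_one_sub_rpow_div_le {a b ρ : ℝ} (ha : 0 < a) (hab : a < b)
    (hρ : ρ ∈ Ico (0 : ℝ) 1) :
    ∫⁻ r in Ioo (0 : ℝ) 1, ENNReal.ofReal ((1 - r) ^ (a - 1) / (1 - r * ρ) ^ b) ≤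
      ENNReal.ofReal ((1 / (b - a) + 1 / a) * (1 - ρ) ^ (a - b)) := by
  have hρ1 : 0 < 1 - ρ := sub_pos.2 hρ.2
  have hsplit : Ioo (0 : ℝ) 1 ⊆ Ioo 0 ρ ∪ Ico ρ 1 := fun r hr => by
    rcases lt_or_ge r ρ with h | h
    · exact Or.inl ⟨hr.1, h⟩
    · exact Or.inr ⟨h, hr.2⟩
  -- for `r < ρ` use `1 - r ≤ 1 - rρ`
  have h1 : ∫⁻ r in Ioo (0 : ℝ) ρ, ENNReal.ofReal ((1 - r) ^ (a - 1) / (1 - r * ρ) ^ b) ≤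
      ENNReal.ofReal (1 / (b - a) * (1 - ρ) ^ (a - b)) := by
    calc ∫⁻ r in Ioo (0 : ℝ) ρ, ENNReal.ofReal ((1 - r) ^ (a - 1) / (1 - r * ρ) ^ b)
        ≤ ∫⁻ r in Ioo (0 : ℝ) ρ, ENNReal.ofReal ((1 - r) ^ (a - b - 1)) := by
          refine setLIntegral_mono' measurableSet_Ioo fun r hr => ENNReal.ofReal_le_ofReal ?_
          have hr1 : 0 < 1 - r := by linarith [hr.2]
          have hle : 1 - r ≤ 1 - r * ρ := by nlinarith [hr.1]
          rw [div_le_iff₀ (Real.rpow_pos_of_pos (hr1.trans_le hle) _),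
            show a - 1 = (a - b - 1) + b by ring, Real.rpow_add hr1]
          exact mul_le_mul_of_nonneg_left (Real.rpow_le_rpow hr1.le hle (ha.trans hab).le)
            (Real.rpow_nonneg hr1.le _)
      _ ≤ _ := by
          rw [lintegral_one_sub_rpow hρ.1 (Or.inr ⟨by intro h; linarith, hρ.2⟩) hρ.2.le]
          refine ENNReal.ofReal_le_ofReal ?_
          rw [show a - b - 1 + 1 = -(b - a) by ring, sub_zero, Real.one_rpow, div_neg, ← neg_div,
            neg_sub, one_div_mul_eq_div, neg_sub]
          refine div_le_div_of_nonneg_right ?_ (by linarith)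
          linarith
  -- for `ρ ≤ r` use `1 - ρ ≤ 1 - rρ`
  have h2 : ∫⁻ r in Ico ρ 1, ENNReal.ofReal ((1 - r) ^ (a - 1) / (1 - r * ρ) ^ b) ≤
      ENNReal.ofReal (1 / a * (1 - ρ) ^ (a - b)) := by
    calc ∫⁻ r in Ico ρ 1, ENNReal.ofReal ((1 - r) ^ (a - 1) / (1 - r * ρ) ^ b)
        ≤ ∫⁻ r in Ico ρ 1, ENNReal.ofReal ((1 - r) ^ (a - 1)) *
            ENNReal.ofReal (((1 - ρ) ^ b)⁻¹) := by
          refine setLIntegral_mono' measurableSet_Ico fun r hr => ?_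
          have hr1 : 0 < 1 - r := by linarith [hr.2]
          have hle : 1 - ρ ≤ 1 - r * ρ := by nlinarith [hr.1, hρ.1, hr.2]
          rw [← ENNReal.ofReal_mul (Real.rpow_nonneg hr1.le _), ← div_eq_mul_inv]
          refine ENNReal.ofReal_le_ofReal ?_
          exact div_le_div_of_nonneg_left (Real.rpow_nonneg hr1.le _) (Real.rpow_pos_of_pos hρ1 _)
            (Real.rpow_le_rpow hρ1.le hle (ha.trans hab).le)
      _ = _ := by
          rw [lintegral_mul_const' _ _ ENNReal.ofReal_ne_top, setLIntegral_congr Ioo_ae_eq_Ico.symm,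
            lintegral_one_sub_rpow hρ.2.le (Or.inl (by linarith)) le_rfl, sub_self,
            sub_add_cancel, Real.zero_rpow ha.ne', sub_zero,
            ← ENNReal.ofReal_mul (div_nonneg (Real.rpow_nonneg hρ1.le _) ha.le)]
          congr 1
          rw [Real.rpow_sub hρ1]
          ring
  calc _ ≤ ∫⁻ r in Ioo 0 ρ ∪ Ico ρ 1, ENNReal.ofReal ((1 - r) ^ (a - 1) / (1 - r * ρ) ^ b) :=
        lintegral_mono_set hsplit
    _ ≤ _ := lintegral_union_le _ _ _
    _ ≤ _ := add_le_add h1 h2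
    _ = _ := by
        have : 0 ≤ (1 - ρ) ^ (a - b) := Real.rpow_nonneg hρ1.le _
        have hba : 0 < b - a := sub_pos.2 hab
        rw [← ENNReal.ofReal_add (by positivity) (by positivity), add_mul]

/-- Countable subadditivity of `x ↦ x ^ p` for `p ≤ 1`. -/
lemma tsum_rpow_le {p : ℝ} (hp : 0 < p) (hp1 : p ≤ 1) (a : ℕ → ℝ≥0∞) :
    (∑' k, a k) ^ p ≤ ∑' k, a k ^ p := by
  have hfin : ∀ s : Finset ℕ, (∑ k ∈ s, a k) ^ p ≤ ∑ k ∈ s, a k ^ p := by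
    intro s
    induction s using Finset.induction_on with
    | empty => simp [hp]
    | insert i s hi ih =>
      rw [Finset.sum_insert hi, Finset.sum_insert hi]
      exact (ENNReal.rpow_add_le_add_rpow _ _ hp.le hp1).trans (by gcongr)
  have hlim := (ENNReal.continuous_rpow_const (y := p)).continuousAt.tendsto.comp
    (ENNReal.summable (f := a)).hasSum
  exact le_of_tendsto hlim (Filter.Eventually.of_forall fun s =>
    (hfin s).trans (ENNReal.sum_le_tsum s))

lemma rpow_le_of_half_le {q x s : ℝ} (hq : 0 < q) (h1 : q / 2 ≤ x) (h2 : x ≤ q) :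
    x ^ s ≤ 2 ^ |s| * q ^ s := by
  have hx : 0 < x := by linarith
  rcases le_total 0 s with hs | hs
  · calc x ^ s ≤ q ^ s := Real.rpow_le_rpow hx.le h2 hs
      _ ≤ _ := le_mul_of_one_le_left (Real.rpow_nonneg hq.le _)
        (Real.one_le_rpow one_le_two (abs_nonneg s))
  · calc x ^ s ≤ (q / 2) ^ s := Real.rpow_le_rpow_of_nonpos (by positivity) h1 hs
      _ = _ := by
        rw [Real.div_rpow hq.le zero_le_two, abs_of_nonpos hs, Real.rpow_neg zero_le_two]
        field_simp

lemma rpow_le_of_le_two_mul {q x s : ℝ} (hq : 0 < q) (h1 : q / 2 ≤ x) (h2 : x ≤ q) :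
    q ^ s ≤ 2 ^ |s| * x ^ s := by
  have hx : 0 < x := by linarith
  rcases le_total 0 s with hs | hs
  · calc q ^ s ≤ (2 * x) ^ s := Real.rpow_le_rpow hq.le (by linarith) hs
      _ = _ := by rw [Real.mul_rpow zero_le_two hx.le, abs_of_nonneg hs]
  · calc q ^ s ≤ x ^ s := Real.rpow_le_rpow_of_nonpos hx h2 hs
      _ ≤ _ := le_mul_of_one_le_left (Real.rpow_nonneg hx.le _)
        (Real.one_le_rpow one_le_two (abs_nonneg s))

/-- The dyadic annulus of all radii `r` with `2⁻ᵏ⁻¹ < 1 - r ≤ 2⁻ᵏ`. -/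
def dyadicInterval (k : ℕ) : Set ℝ := Ico (1 - (1 / 2) ^ k) (1 - (1 / 2) ^ (k + 1))

lemma measurableSet_dyadicInterval (k : ℕ) : MeasurableSet (dyadicInterval k) := measurableSet_Ico

lemma volume_dyadicInterval (k : ℕ) :
    volume (dyadicInterval k) = ENNReal.ofReal ((1 / 2) ^ (k + 1)) := by
  rw [dyadicInterval, Real.volume_Ico]
  congr 1
  ring

lemma Ioo_subset_iUnion_dyadicInterval : Ioo (0 : ℝ) 1 ⊆ ⋃ k, dyadicInterval k := by
  intro r hr
  obtain ⟨k, hk1, hk2⟩ := exists_nat_pow_near_of_lt_one (x := 1 - r) (y := 1 / 2)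
    (by linarith [hr.2]) (by linarith [hr.1]) (by norm_num) (by norm_num)
  exact mem_iUnion.2 ⟨k, by linarith, by linarith⟩

lemma dyadicInterval_succ_subset (k : ℕ) : dyadicInterval (k + 1) ⊆ Ioo 0 1 := by
  intro r hr
  have h1 : (1 / 2 : ℝ) ^ (k + 1) < 1 := pow_lt_one₀ (by norm_num) (by norm_num) (by simp)
  have h2 : (0 : ℝ) < (1 / 2) ^ (k + 1 + 1) := by positivity
  exact ⟨by linarith [hr.1], by linarith [hr.2]⟩

lemma pairwise_disjoint_dyadicInterval : Pairwise (Function.onFun Disjoint dyadicInterval) := by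
  have hmono : Monotone fun k : ℕ => 1 - (1 / 2 : ℝ) ^ k := fun i j hij =>
    sub_le_sub_left (pow_le_pow_of_le_one (by norm_num) (by norm_num) hij) _
  exact hmono.pairwise_disjoint_on_Ico_succ

/-- A Hardy-type inequality for `p ≤ 1`, valid because the functions are monotone: on dyadic
annuli they are comparable to constants, and `x ↦ x ^ p` is subadditive. -/
theorem exists_lintegral_kernel_rpow_le {p α t : ℝ} (hp : 0 < p) (hp1 : p ≤ 1) (hα : 0 < α)
    (ht : α - 1 < t) :
    ∃ C : ℝ≥0∞, C ≠ ∞ ∧ ∀ M : ℝ → ℝ≥0∞, MonotoneOn M (Ico 0 1) →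
      ∫⁻ ρ in Ioo (0 : ℝ) 1, (∫⁻ r in Ioo (0 : ℝ) 1,
          M r * ENNReal.ofReal ((1 - r) ^ t / (1 - r * ρ) ^ (t + 1))) ^ p *
          ENNReal.ofReal ((1 - ρ) ^ (p * α - 1)) ≤
        C * ∫⁻ r in Ioo (0 : ℝ) 1, M r ^ p * ENNReal.ofReal ((1 - r) ^ (α * p - 1)) := by
  set A : ℝ := 1 / (p * (t + 1) - p * α) + 1 / (p * α) with hA
  have hpα : 0 < p * α := mul_pos hp hα
  have hpt : p * α < p * (t + 1) := mul_lt_mul_of_pos_left (by linarith) hp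
  have hA0 : 0 ≤ A := by
    have : 0 < p * (t + 1) - p * α := sub_pos.2 hpt
    positivity
  have ht1 : 0 < t + 1 := by linarith
  obtain ⟨B, hB⟩ : ∃ B : ℝ, B = 2 ^ |t| * 2 ^ t := ⟨_, rfl⟩
  have hB0 : 0 < B := by rw [hB]; positivity
  set D : ℝ := B ^ p * A * (2 * 2 ^ |α * p - 1|) with hD
  refine ⟨ENNReal.ofReal D, ENNReal.ofReal_ne_top, fun M hM => ?_⟩
  set q : ℕ → ℝ := fun k => (1 / 2) ^ (k + 1) with hq
  have hq0 : ∀ k, 0 < q k := fun k => by positivity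
  have hq1 : ∀ k, q k < 1 := fun k => pow_lt_one₀ (by norm_num) (by norm_num) (by simp)
  have hqmem : ∀ k, 1 - q k ∈ Ico (0 : ℝ) 1 := fun k =>
    ⟨by linarith [hq1 k], by linarith [hq0 k]⟩
  -- the contribution of one annulus to the inner integral
  have hinner : ∀ ρ ∈ Ioo (0 : ℝ) 1, ∀ k,
      ∫⁻ r in dyadicInterval k ∩ Ioo 0 1,
        M r * ENNReal.ofReal ((1 - r) ^ t / (1 - r * ρ) ^ (t + 1)) ≤
      M (1 - q k) * ENNReal.ofReal (B * q k ^ (t + 1) / (1 - ρ * (1 - q k)) ^ (t + 1)) := by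
    intro ρ hρ k
    have hk2 : (1 / 2 : ℝ) ^ k = 2 * q k := by rw [hq]; simp only [pow_succ]; ring
    have hden : 0 < 1 - ρ * (1 - q k) := by nlinarith [hρ.1, hρ.2, hq0 k, hq1 k]
    have hpt : ∀ r ∈ dyadicInterval k ∩ Ioo 0 1,
        M r * ENNReal.ofReal ((1 - r) ^ t / (1 - r * ρ) ^ (t + 1)) ≤
        M (1 - q k) * ENNReal.ofReal (2 ^ |t| * (2 * q k) ^ t / (1 - ρ * (1 - q k)) ^ (t + 1)) := by
      rintro r ⟨hr, hr01⟩
      have hr1 : q k < 1 - r := by linarith [hr.2]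
      have hr2 : 1 - r ≤ 2 * q k := by linarith [hr.1]
      have hle : 1 - ρ * (1 - q k) ≤ 1 - r * ρ := by nlinarith [hρ.1]
      refine mul_le_mul' (hM ⟨hr01.1.le, hr01.2⟩ (hqmem k) (by linarith)) ?_
      refine ENNReal.ofReal_le_ofReal ?_
      exact div_le_div₀ (by have := hq0 k; positivity)
        (rpow_le_of_half_le (by linarith [hq0 k]) (by linarith) hr2)
        (Real.rpow_pos_of_pos hden _) (Real.rpow_le_rpow hden.le hle ht1.le)
    calc _ ≤ ∫⁻ _ in dyadicInterval k ∩ Ioo 0 1, M (1 - q k) *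
          ENNReal.ofReal (2 ^ |t| * (2 * q k) ^ t / (1 - ρ * (1 - q k)) ^ (t + 1)) :=
          setLIntegral_mono' ((measurableSet_dyadicInterval k).inter measurableSet_Ioo) hpt
      _ ≤ M (1 - q k) *
          ENNReal.ofReal (2 ^ |t| * (2 * q k) ^ t / (1 - ρ * (1 - q k)) ^ (t + 1)) *
          ENNReal.ofReal (q k) := by
          rw [setLIntegral_const]
          exact mul_le_mul_right
            ((measure_mono inter_subset_left).trans_eq (volume_dyadicInterval k)) _
      _ = _ := by
          rw [mul_assoc, ← ENNReal.ofReal_mul (by have := hq0 k; positivity)]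
          congr 2
          rw [Real.rpow_add_one (hq0 k).ne', Real.mul_rpow zero_le_two (hq0 k).le, hB]
          ring
  -- the `p`-th power of the inner integral is at most the sum of the `p`-th powers
  have hpow : ∀ ρ ∈ Ioo (0 : ℝ) 1, (∫⁻ r in Ioo (0 : ℝ) 1,
      M r * ENNReal.ofReal ((1 - r) ^ t / (1 - r * ρ) ^ (t + 1))) ^ p *
        ENNReal.ofReal ((1 - ρ) ^ (p * α - 1)) ≤
      ∑' k, M (1 - q k) ^ p * ENNReal.ofReal (B ^ p * q k ^ (p * (t + 1))) *
        ENNReal.ofReal ((1 - ρ) ^ (p * α - 1) / (1 - ρ * (1 - q k)) ^ (p * (t + 1))) := by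
    intro ρ hρ
    have h1 : ∫⁻ r in Ioo (0 : ℝ) 1, M r * ENNReal.ofReal ((1 - r) ^ t / (1 - r * ρ) ^ (t + 1)) ≤
        ∑' k, M (1 - q k) *
          ENNReal.ofReal (B * q k ^ (t + 1) / (1 - ρ * (1 - q k)) ^ (t + 1)) := by
      have hsub : Ioo (0 : ℝ) 1 ⊆ ⋃ k, dyadicInterval k ∩ Ioo 0 1 := fun r hr => by
        obtain ⟨k, hk⟩ := mem_iUnion.1 (Ioo_subset_iUnion_dyadicInterval hr)
        exact mem_iUnion.2 ⟨k, hk, hr⟩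
      exact ((lintegral_mono_set hsub).trans (lintegral_iUnion_le _ _)).trans
        (ENNReal.tsum_le_tsum (hinner ρ hρ))
    refine (mul_le_mul_left ((ENNReal.rpow_le_rpow h1 hp.le).trans (tsum_rpow_le hp hp1 _))
      _).trans_eq ?_
    rw [← ENNReal.tsum_mul_right]
    refine tsum_congr fun k => ?_
    have hqk := hq0 k
    have hden : 0 < 1 - ρ * (1 - q k) := by nlinarith [hρ.1, hρ.2, hq0 k, hq1 k]
    rw [ENNReal.mul_rpow_of_nonneg _ _ hp.le, ENNReal.ofReal_rpow_of_nonneg (by positivity) hp.le,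
      mul_assoc, mul_assoc, ← ENNReal.ofReal_mul (by positivity),
      ← ENNReal.ofReal_mul (by positivity),
      Real.div_rpow (by positivity) (by positivity), Real.mul_rpow hB0.le (by positivity),
      ← Real.rpow_mul hqk.le, ← Real.rpow_mul hden.le, mul_comm (t + 1) p]
    congr 2
    ring
  have hmeas : ∀ k, Measurable fun ρ : ℝ =>
      ENNReal.ofReal ((1 - ρ) ^ (p * α - 1) / (1 - ρ * (1 - q k)) ^ (p * (t + 1))) := fun k => by
    fun_prop
  -- comparison of one term with the integral over the next annulus
  have hterm : ∀ k, M (1 - q k) ^ p * ENNReal.ofReal (q k ^ (p * α)) ≤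
      ENNReal.ofReal (2 * 2 ^ |α * p - 1|) *
        ∫⁻ r in dyadicInterval (k + 1), M r ^ p * ENNReal.ofReal ((1 - r) ^ (α * p - 1)) := by
    intro k
    have hqk := hq0 k
    have hq' : (1 / 2 : ℝ) ^ (k + 1 + 1) = q k / 2 := by rw [hq]; simp only [pow_succ]; ring
    have hlow : M (1 - q k) ^ p * ENNReal.ofReal (q k ^ (α * p - 1) / 2 ^ |α * p - 1|) *
        ENNReal.ofReal (q k / 2) ≤
        ∫⁻ r in dyadicInterval (k + 1), M r ^ p * ENNReal.ofReal ((1 - r) ^ (α * p - 1)) := by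
      rw [← hq', ← volume_dyadicInterval, ← setLIntegral_const]
      refine setLIntegral_mono' (measurableSet_dyadicInterval _) fun r hr => ?_
      have hr01 := dyadicInterval_succ_subset k hr
      have hr1 : 1 - q k ≤ r := hr.1
      have hr2 : r < 1 - (1 / 2) ^ (k + 1 + 1) := hr.2
      rw [hq'] at hr2
      refine mul_le_mul' (ENNReal.rpow_le_rpow (hM (hqmem k) ⟨hr01.1.le, hr01.2⟩ hr1) hp.le)
        (ENNReal.ofReal_le_ofReal ?_)
      rw [div_le_iff₀' (by positivity)]
      exact rpow_le_of_le_two_mul hqk (by linarith) (by linarith)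
    refine le_trans (le_of_eq ?_) (mul_le_mul_right hlow _)
    rw [mul_assoc, mul_left_comm, ← ENNReal.ofReal_mul (by positivity),
      ← ENNReal.ofReal_mul (by positivity)]
    congr 2
    rw [mul_comm p α, Real.rpow_sub_one hqk.ne']
    field_simp
  calc _ ≤ ∫⁻ ρ in Ioo (0 : ℝ) 1,
        ∑' k, M (1 - q k) ^ p * ENNReal.ofReal (B ^ p * q k ^ (p * (t + 1))) *
          ENNReal.ofReal ((1 - ρ) ^ (p * α - 1) / (1 - ρ * (1 - q k)) ^ (p * (t + 1))) :=
        setLIntegral_mono' measurableSet_Ioo hpow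
    _ = ∑' k, M (1 - q k) ^ p * ENNReal.ofReal (B ^ p * q k ^ (p * (t + 1))) *
          ∫⁻ ρ in Ioo (0 : ℝ) 1,
            ENNReal.ofReal ((1 - ρ) ^ (p * α - 1) / (1 - ρ * (1 - q k)) ^ (p * (t + 1))) := by
        rw [lintegral_tsum fun k => ((hmeas k).const_mul _).aemeasurable]
        exact tsum_congr fun k => lintegral_const_mul _ (hmeas k)
    _ ≤ ∑' k, M (1 - q k) ^ p * ENNReal.ofReal (B ^ p * q k ^ (p * (t + 1))) *
          ENNReal.ofReal (A * q k ^ (p * α - p * (t + 1))) := by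
        refine ENNReal.tsum_le_tsum fun k => mul_le_mul_right ?_ _
        have := lintegral_one_sub_rpow_div_le hpα hpt (hqmem k)
        rwa [sub_sub_cancel] at this
    _ = ∑' k, ENNReal.ofReal (B ^ p * A) *
          (M (1 - q k) ^ p * ENNReal.ofReal (q k ^ (p * α))) := by
        refine tsum_congr fun k => ?_
        have hqk := hq0 k
        rw [mul_assoc, mul_left_comm (ENNReal.ofReal (B ^ p * A)),
          ← ENNReal.ofReal_mul (by positivity), ← ENNReal.ofReal_mul (by positivity)]
        congr 2
        rw [Real.rpow_sub hqk]
        field_simp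
    _ ≤ ∑' k, ENNReal.ofReal (B ^ p * A) * (ENNReal.ofReal (2 * 2 ^ |α * p - 1|) *
          ∫⁻ r in dyadicInterval (k + 1), M r ^ p * ENNReal.ofReal ((1 - r) ^ (α * p - 1))) :=
        ENNReal.tsum_le_tsum fun k => mul_le_mul_right (hterm k) _
    _ = ENNReal.ofReal D * ∫⁻ r in ⋃ k, dyadicInterval (k + 1),
          M r ^ p * ENNReal.ofReal ((1 - r) ^ (α * p - 1)) := by
        rw [ENNReal.tsum_mul_left, ENNReal.tsum_mul_left, ← mul_assoc,
          ← ENNReal.ofReal_mul (by positivity), hD,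
          lintegral_iUnion (s := fun k => dyadicInterval (k + 1)) (fun k => measurableSet_dyadicInterval _)
            (fun i j hij => pairwise_disjoint_dyadicInterval (by simpa using hij))]
    _ ≤ _ := mul_le_mul_right (lintegral_mono_set
        (iUnion_subset fun k => dyadicInterval_succ_subset k)) _

end OneDimensional

end HarmonicDist

/-! ### Harmonicity of averages along rays -/

namespace HarmonicDist

open Metric Topology InnerProductSpace
open scoped Laplacian

section RayIntegral

variable {V : Type*} [NormedAddCommGroup V] [InnerProductSpace ℝ V] [FiniteDimensional ℝ V]
  [MeasurableSpace V] [BorelSpace V]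
  {W : Type*} [NormedAddCommGroup W] [NormedSpace ℝ W] [CompleteSpace W]

lemma integrableOn_smul_comp_sq_smul {H : V → W} (hH : ContinuousOn H (ball 0 1)) {w : ℝ → ℝ}
    (hw : Continuous w) {A : Set ℝ} (hA : A ⊆ Icc 0 1) {x : V} (hx : x ∈ ball (0 : V) 1) :
    IntegrableOn (fun r => w r • H (r ^ 2 • x)) A :=
  ((hw.continuousOn.smul (continuousOn_comp_sq_smul hH hx)).integrableOn_compact
    isCompact_Icc).mono_set hA

/-- Differentiation under the integral sign for averages of a function along rays. -/
lemma hasFDerivAt_rayIntegral {H : V → W} (hH : ∀ z ∈ ball (0 : V) 1, ContDiffAt ℝ 1 H z)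
    {w : ℝ → ℝ} (hw : Continuous w) {A : Set ℝ} (hAm : MeasurableSet A) (hA : A ⊆ Icc 0 1) {x : V}
    (hx : x ∈ ball (0 : V) 1) :
    HasFDerivAt (fun x => ∫ r in A, w r • H (r ^ 2 • x))
      (∫ r in A, (w r * r ^ 2) • fderiv ℝ H (r ^ 2 • x)) x := by
  obtain ⟨R, hxR, hR1⟩ := exists_between (show ‖x‖ < 1 by simpa using hx)
  have hHc : ContinuousOn H (ball 0 1) := fun z hz => (hH z hz).continuousAt.continuousWithinAt
  have hDc : ContinuousOn (fderiv ℝ H) (ball 0 1) := fun z hz =>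
    ((hH z hz).fderiv_right (m := 0) (by norm_num)).continuousAt.continuousWithinAt
  have hsub : closedBall (0 : V) R ⊆ ball 0 1 := closedBall_subset_ball hR1
  obtain ⟨C, hC⟩ := (isCompact_closedBall (0 : V) R).exists_bound_of_continuousOn (hDc.mono hsub)
  obtain ⟨C', hC'⟩ := (isCompact_Icc (a := (0 : ℝ)) (b := 1)).exists_bound_of_continuousOn
    (f := fun r => w r * r ^ 2) (Continuous.continuousOn (by fun_prop))
  have hAfin : IsFiniteMeasure (volume.restrict A) :=
    ⟨by
      rw [Measure.restrict_apply_univ]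
      exact (measure_mono hA).trans_lt (by simp)⟩
  have hw2 : Continuous fun r => w r * r ^ 2 := by fun_prop
  have hnhds : ball (0 : V) R ∈ 𝓝 x := isOpen_ball.mem_nhds (by simpa using hxR)
  refine hasFDerivAt_integral_of_dominated_of_fderiv_le (bound := fun _ => C' * C)
    (F := fun x r => w r • H (r ^ 2 • x))
    (F' := fun x r => (w r * r ^ 2) • fderiv ℝ H (r ^ 2 • x)) hnhds ?_ ?_ ?_ ?_
    (integrable_const _) ?_
  · filter_upwards [hnhds] with y hy
    exact (integrableOn_smul_comp_sq_smul hHc hw hA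
      (hsub (ball_subset_closedBall hy))).aestronglyMeasurable
  · exact integrableOn_smul_comp_sq_smul hHc hw hA hx
  · exact (integrableOn_smul_comp_sq_smul hDc hw2 hA hx).aestronglyMeasurable
  · filter_upwards [ae_restrict_mem hAm] with r hr y hy
    have hr2 : r ^ 2 ≤ 1 := pow_le_one₀ (hA hr).1 (hA hr).2
    have hy : ‖y‖ < R := by simpa using hy
    rw [norm_smul]
    refine mul_le_mul (hC' r (hA hr)) (hC _ ?_) (norm_nonneg _)
      ((norm_nonneg _).trans (hC' r (hA hr)))
    rw [mem_closedBall_zero_iff, norm_smul, norm_pow, Real.norm_of_nonneg (hA hr).1]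
    nlinarith [norm_nonneg y, sq_nonneg r]
  · filter_upwards [ae_restrict_mem hAm] with r hr y hy
    have hmem := sq_smul_mem_unitBall (hsub (ball_subset_closedBall hy)) (hA hr)
    have h1 := ((hH _ hmem).differentiableAt (by norm_num)).hasFDerivAt
    have h2 : HasFDerivAt (fun y : V => r ^ 2 • y) (r ^ 2 • ContinuousLinearMap.id ℝ V) y :=
      (hasFDerivAt_id y).const_smul (r ^ 2)
    refine ((h1.comp y h2).const_smul (w r)).congr_fderiv ?_
    ext v
    simp [smul_smul]

set_option maxSynthPendingDepth 3 in
/-- Averages of a harmonic function along rays are harmonic. -/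
theorem harmonicAt_rayIntegral {G : V → W} (hG : ∀ z ∈ ball (0 : V) 1, HarmonicAt G z) {w : ℝ → ℝ}
    (hw : Continuous w) {A : Set ℝ} (hAm : MeasurableSet A) (hA : A ⊆ Icc 0 1) :
    ∀ x ∈ ball (0 : V) 1, HarmonicAt (fun x => ∫ r in A, w r • G (r ^ 2 • x)) x := by
  set b := stdOrthonormalBasis ℝ V
  set F : V → W := fun x => ∫ r in A, w r • G (r ^ 2 • x) with hF
  have hsm : ∀ z ∈ ball (0 : V) 1, ContDiffAt ℝ 3 G z := fun z hz => by
    exact_mod_cast contDiffAt_infty.1 (hG z hz).contDiffAt_infty 3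
  have hw2 : Continuous fun r => w r * r ^ 2 := by fun_prop
  have hw4 : Continuous fun r => w r * r ^ 2 * r ^ 2 := by fun_prop
  have h0 := fun x (hx : x ∈ ball (0 : V) 1) => hasFDerivAt_rayIntegral
    (fun z hz => (hsm z hz).of_le (by norm_num)) hw hAm hA hx
  have h1 := fun x (hx : x ∈ ball (0 : V) 1) => hasFDerivAt_rayIntegral (H := fderiv ℝ G)
    (fun z hz => (hsm z hz).fderiv_right (by norm_num)) hw2 hAm hA hx
  have hD2 : ∀ z ∈ ball (0 : V) 1, ContDiffAt ℝ 1 (fderiv ℝ (fderiv ℝ G)) z := fun z hz =>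
    ((hsm z hz).fderiv_right (m := 2) (by norm_num)).fderiv_right (by norm_num)
  have h2 := fun x (hx : x ∈ ball (0 : V) 1) => hasFDerivAt_rayIntegral
    (H := fderiv ℝ (fderiv ℝ G)) hD2 hw4 hAm hA hx
  have hnhds : ∀ x ∈ ball (0 : V) 1, ball (0 : V) 1 ∈ 𝓝 x := fun x hx => isOpen_ball.mem_nhds hx
  have hlap : ∀ x ∈ ball (0 : V) 1, Δ F x = 0 := by
    intro x hx
    have he : fderiv ℝ F =ᶠ[𝓝 x] fun x => ∫ r in A, (w r * r ^ 2) • fderiv ℝ G (r ^ 2 • x) := by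
      filter_upwards [hnhds x hx] with y hy using (h0 y hy).fderiv
    rw [laplacian_eq_sum_fderiv, he.fderiv_eq, (h1 x hx).fderiv]
    let l : (V →L[ℝ] V →L[ℝ] W) →L[ℝ] W := ∑ i,
      (ContinuousLinearMap.apply ℝ W (b i)).comp (ContinuousLinearMap.apply ℝ (V →L[ℝ] W) (b i))
    have hl : ∀ φ : V →L[ℝ] V →L[ℝ] W, l φ = ∑ i, φ (b i) (b i) := fun φ => by
      simp [l]
    have hint : IntegrableOn
        (fun r => (w r * r ^ 2 * r ^ 2) • fderiv ℝ (fderiv ℝ G) (r ^ 2 • x)) A :=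
      integrableOn_smul_comp_sq_smul
        (fun z hz => (hD2 z hz).continuousAt.continuousWithinAt) hw4 hA hx
    rw [← hl, ← l.integral_comp_comm hint]
    refine setIntegral_eq_zero_of_forall_eq_zero fun r hr => ?_
    rw [map_smul, hl, ← laplacian_eq_sum_fderiv,
      (hG _ (sq_smul_mem_unitBall hx (hA hr))).2.self_of_nhds, Pi.zero_apply, smul_zero]
  intro x hx
  refine ⟨?_, ?_⟩
  · have hc0 : ContDiffAt ℝ 0
        (fun x => ∫ r in A, (w r * r ^ 2 * r ^ 2) • fderiv ℝ (fderiv ℝ G) (r ^ 2 • x)) x :=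
      contDiffAt_zero.2 ⟨ball 0 1, hnhds x hx,
        fun y hy => (h2 y hy).continuousAt.continuousWithinAt⟩
    have hc1 : ContDiffAt ℝ (0 + 1)
        (fun x => ∫ r in A, (w r * r ^ 2) • fderiv ℝ G (r ^ 2 • x)) x :=
      contDiffAt_succ_iff_hasFDerivAt.2 ⟨_, ⟨ball 0 1, hnhds x hx, h1⟩, hc0⟩
    have hc2 : ContDiffAt ℝ (1 + 1) F x :=
      contDiffAt_succ_iff_hasFDerivAt.2 ⟨_, ⟨ball 0 1, hnhds x hx, h0⟩, by simpa using hc1⟩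
    exact hc2.of_le (by norm_num)
  · filter_upwards [hnhds x hx] with y hy using hlap y hy

end RayIntegral

end HarmonicDist

/-! ### Splitting the reproducing formula along the level set -/

namespace HarmonicDist

open Metric Topology InnerProductSpace

section Decomposition

variable {n : ℕ} {𝕜 : Type*} [RCLike 𝕜]

/-- The weight of the reproducing formula along rays. -/
def rayWeight (m : ℕ) (r : ℝ) : ℝ := 2 * r * (1 - r ^ 2) ^ m / m.factorial

/-- The contribution of the radii in `A` to the reproducing formula for `f`. -/
def rayPart (m : ℕ) (A : Set ℝ) (f : E n → 𝕜) (x : E n) : 𝕜 :=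
  ∫ r in A, rayWeight m r • radialDeriv (m + 1) f (r ^ 2 • x)

lemma continuous_rayWeight (m : ℕ) : Continuous (rayWeight m) := by
  unfold rayWeight; fun_prop

lemma isHarmonicOnBall_rayPart (m : ℕ) {A : Set ℝ} (hAm : MeasurableSet A) (hA : A ⊆ Ioo 0 1)
    {f : E n → 𝕜} (hf : IsHarmonicOnBall f) : IsHarmonicOnBall (rayPart m A f) :=
  harmonicAt_rayIntegral (isHarmonicOnBall_radialDeriv (m + 1) hf) (continuous_rayWeight m) hAm
    (hA.trans Ioo_subset_Icc_self)

lemma rayPart_Ioo (m : ℕ) {f : E n → 𝕜} (hf : IsHarmonicOnBall f) {x : E n}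
    (hx : x ∈ ball (0 : E n) 1) : rayPart m (Ioo 0 1) f x = f x := by
  have h := integral_radialDeriv_eq hf hx m
  rw [intervalIntegral.integral_of_le zero_le_one, integral_Ioc_eq_integral_Ioo] at h
  have hm : (m.factorial : ℝ) ≠ 0 := by exact_mod_cast m.factorial_ne_zero
  rw [rayPart, ← inv_smul_smul₀ hm (f x), ← h, ← integral_smul]
  congr 1
  ext r
  rw [rayWeight, smul_smul]
  congr 1
  ring

lemma rayPart_add_rayPart (m : ℕ) {A : Set ℝ} (hAm : MeasurableSet A) {f : E n → 𝕜}
    (hf : IsHarmonicOnBall f) {x : E n} (hx : x ∈ ball (0 : E n) 1) :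
    rayPart m (Ioo 0 1 ∩ A) f x + rayPart m (Ioo 0 1 \ A) f x = f x := by
  rw [← rayPart_Ioo m hf hx]
  exact integral_inter_add_sdiff hAm (integrableOn_smul_comp_sq_smul
    (isHarmonicOnBall_continuousOn (isHarmonicOnBall_radialDeriv (m + 1) hf))
    (continuous_rayWeight m) Ioo_subset_Icc_self hx)

/-- Minkowski's inequality for averages along rays. The radius `r² ρ` is written `r (rρ)`, the form
in which `exists_M1_radialDeriv_le` bounds it by `M1 G r`. -/
lemma M1_rayIntegral_le {G : E n → 𝕜} (hG : ContinuousOn G (ball 0 1)) {w : ℝ → ℝ}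
    (hw : Continuous w) {A : Set ℝ} (hAm : MeasurableSet A) (hA : A ⊆ Ioo 0 1) {ρ : ℝ}
    (hρ : ρ ∈ Ico (0 : ℝ) 1) :
    M1 (fun x => ∫ r in A, w r • G (r ^ 2 • x)) ρ ≤ ∫⁻ r in A, ‖w r‖ₑ * M1 G (r * (r * ρ)) := by
  set F : E n → ℝ≥0∞ := (ball (0 : E n) 1).indicator fun z => ‖G z‖ₑ with hF
  have hFm : Measurable F := measurable_indicator_unitBall hG
  have hFeq : ∀ r ∈ A, ∀ x : sphere (0 : E n) 1,
      ‖G (r ^ 2 • ρ • (x : E n))‖ₑ = F ((r * (r * ρ)) • (x : E n)) := by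
    intro r hr x
    have hmem : (r * (r * ρ)) • (x : E n) ∈ ball (0 : E n) 1 := by
      have := sq_smul_mem_unitBall (smul_mem_unitBall hρ x) (Ioo_subset_Icc_self (hA hr))
      rwa [smul_smul, show r ^ 2 * ρ = r * (r * ρ) by ring] at this
    rw [hF, indicator_of_mem hmem, smul_smul, show r ^ 2 * ρ = r * (r * ρ) by ring]
  calc M1 (fun x => ∫ r in A, w r • G (r ^ 2 • x)) ρ
      ≤ ∫⁻ x : sphere (0 : E n) 1, (∫⁻ r in A, ‖w r‖ₑ * F ((r * (r * ρ)) • (x : E n)))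
          ∂(sphereMeasure n) := by
        refine lintegral_mono fun x => (enorm_integral_le_lintegral_enorm _).trans ?_
        refine setLIntegral_mono' hAm fun r hr => ?_
        rw [enorm_smul, hFeq r hr x]
    _ = ∫⁻ r in A, (∫⁻ x : sphere (0 : E n) 1, ‖w r‖ₑ * F ((r * (r * ρ)) • (x : E n))
          ∂(sphereMeasure n)) := by
        rw [lintegral_lintegral_swap]
        exact ((hw.measurable.enorm.comp measurable_snd).mul
          (hFm.comp (by fun_prop))).aemeasurable
    _ = ∫⁻ r in A, ‖w r‖ₑ * M1 G (r * (r * ρ)) := by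
        refine setLIntegral_congr_fun hAm fun r hr => ?_
        rw [lintegral_const_mul' _ _ (by simp), M1]
        congr 1
        refine lintegral_congr fun x => ?_
        rw [← hFeq r hr x, smul_smul, show r ^ 2 * ρ = r * (r * ρ) by ring]

/-- The parts of the reproducing formula are controlled by a one-dimensional kernel. -/
theorem exists_M1_rayPart_le (n : ℕ) [NeZero n] (𝕜 : Type*) [RCLike 𝕜] (m : ℕ) :
    ∃ K : ℝ, 0 ≤ K ∧ ∀ f : E n → 𝕜, IsHarmonicOnBall f → ∀ A : Set ℝ, MeasurableSet A →
      A ⊆ Ioo 0 1 → ∀ ρ ∈ Ico (0 : ℝ) 1,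
      M1 (rayPart m A f) ρ ≤ ENNReal.ofReal K *
        ∫⁻ r in A, M1 f r * ENNReal.ofReal ((1 - r) ^ (m : ℝ) / (1 - r * ρ) ^ ((m : ℝ) + 1)) := by
  obtain ⟨K, hK0, hK⟩ := exists_M1_radialDeriv_le n 𝕜 (m + 1)
  refine ⟨2 * 2 ^ m / m.factorial * K, by positivity, fun f hf A hAm hA ρ hρ => ?_⟩
  refine (M1_rayIntegral_le (isHarmonicOnBall_continuousOn (isHarmonicOnBall_radialDeriv (m + 1) hf))
    (continuous_rayWeight m) hAm hA hρ).trans ?_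
  rw [← lintegral_const_mul' _ _ ENNReal.ofReal_ne_top]
  refine setLIntegral_mono' hAm fun r hr => ?_
  have hr0 := (hA hr).1
  have hr1 := (hA hr).2
  have h1r : 0 < 1 - r := sub_pos.2 hr1
  have hrρ : r * ρ ∈ Ico (0 : ℝ) 1 := ⟨mul_nonneg hr0.le hρ.1, by nlinarith [hρ.1, hρ.2]⟩
  have hden : 0 < 1 - r * ρ := sub_pos.2 hrρ.2
  have hw : ‖rayWeight m r‖ₑ ≤ ENNReal.ofReal (2 * 2 ^ m / m.factorial * (1 - r) ^ m) := by
    have h2 : 0 ≤ 1 - r ^ 2 := by nlinarith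
    rw [rayWeight, Real.enorm_of_nonneg (by positivity)]
    refine ENNReal.ofReal_le_ofReal ?_
    rw [div_mul_eq_mul_div]
    refine div_le_div_of_nonneg_right ?_ (by positivity)
    have h3 : (1 - r ^ 2) ^ m ≤ (2 * (1 - r)) ^ m := pow_le_pow_left₀ h2 (by nlinarith) m
    calc 2 * r * (1 - r ^ 2) ^ m ≤ 2 * 1 * (2 * (1 - r)) ^ m := by gcongr
      _ = _ := by rw [mul_pow]; ring
  calc ‖rayWeight m r‖ₑ * M1 (radialDeriv (m + 1) f) (r * (r * ρ))
      ≤ ENNReal.ofReal (2 * 2 ^ m / m.factorial * (1 - r) ^ m) *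
        (ENNReal.ofReal (K / (1 - r * ρ) ^ (m + 1)) * M1 f r) :=
        mul_le_mul' hw (hK f hf r ⟨hr0.le, hr1⟩ _ hrρ)
    _ = _ := by
        rw [mul_comm (M1 f r), ← mul_assoc, ← mul_assoc, ← ENNReal.ofReal_mul (by positivity),
          ← ENNReal.ofReal_mul (by positivity), Real.rpow_natCast,
          show (m : ℝ) + 1 = ((m + 1 : ℕ) : ℝ) by push_cast; rfl, Real.rpow_natCast]
        congr 2
        ring

lemma measurableSet_L (ε α : ℝ) {f : E n → 𝕜} (hf : IsHarmonicOnBall f) :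
    MeasurableSet (L ε α f) := by
  classical
  have hM : Measurable ((Ico (0 : ℝ) 1).piecewise (M1 f) fun _ => 0) :=
    (continuousOn_M1 (isHarmonicOnBall_continuousOn hf)).measurable_piecewise continuousOn_const
      measurableSet_Ico
  have h : L ε α f = Ico 0 1 ∩ {r | ENNReal.ofReal ε ≤ ENNReal.ofReal ((1 - r) ^ α) *
      (Ico (0 : ℝ) 1).piecewise (M1 f) (fun _ => 0) r} := by
    ext r
    simp only [L, mem_ofPred_eq, mem_inter_iff]
    refine and_congr_right fun hr => ?_
    rw [piecewise_eq_of_mem _ _ _ hr]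
  rw [h]
  exact measurableSet_Ico.inter (measurableSet_le measurable_const
    (Measurable.mul (by fun_prop) hM))

lemma inner_levelIntegral_eq (α t ε ρ : ℝ) {f : E n → 𝕜} (hf : IsHarmonicOnBall f) :
    ∫⁻ r in Ioo (0 : ℝ) 1, (L ε α f).indicator
        (fun r => ENNReal.ofReal ((1 - r) ^ (t - α) / (1 - r * ρ) ^ (t + 1))) r =
      ∫⁻ r in Ioo (0 : ℝ) 1 ∩ L ε α f,
        ENNReal.ofReal ((1 - r) ^ (t - α) / (1 - r * ρ) ^ (t + 1)) := by
  rw [setLIntegral_indicator (measurableSet_L ε α hf), inter_comm]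

lemma ofReal_rpow_mul_kernel {α s u ρ r : ℝ} (hr : r < 1) :
    ENNReal.ofReal ((1 - r) ^ s / (1 - r * ρ) ^ u) = ENNReal.ofReal ((1 - r) ^ α) *
      ENNReal.ofReal ((1 - r) ^ (s - α) / (1 - r * ρ) ^ u) := by
  have h1r : 0 < 1 - r := sub_pos.2 hr
  rw [← ENNReal.ofReal_mul (Real.rpow_nonneg h1r.le _), ← mul_div_assoc, ← Real.rpow_add h1r,
    add_sub_cancel]

/-- The kernel decreases in the exponent, since `1 - r ≤ 1 - rρ`; this permits replacing the real
exponent `t` by an integer `m ≥ t`. -/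
lemma kernel_le_kernel {s t r ρ : ℝ} (hst : t ≤ s) (hr : r ∈ Ioo (0 : ℝ) 1)
    (hρ : ρ ∈ Ico (0 : ℝ) 1) (α : ℝ) :
    (1 - r) ^ (s - α) / (1 - r * ρ) ^ (s + 1) ≤ (1 - r) ^ (t - α) / (1 - r * ρ) ^ (t + 1) := by
  have h1r : 0 < 1 - r := sub_pos.2 hr.2
  have hle : 1 - r ≤ 1 - r * ρ := by nlinarith [hr.1, hρ.2]
  have hden : 0 < 1 - r * ρ := h1r.trans_le hle
  rw [div_le_div_iff₀ (by positivity) (by positivity), show s - α = (t - α) + (s - t) by ring,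
    show s + 1 = (t + 1) + (s - t) by ring, Real.rpow_add h1r, Real.rpow_add hden (t + 1)]
  have := Real.rpow_le_rpow h1r.le hle (sub_nonneg.2 hst)
  calc (1 - r) ^ (t - α) * (1 - r) ^ (s - t) * (1 - r * ρ) ^ (t + 1)
      ≤ (1 - r) ^ (t - α) * (1 - r * ρ) ^ (s - t) * (1 - r * ρ) ^ (t + 1) := by gcongr
    _ = _ := by ring

/-- Where `r ∉ L ε α f`, the mean `M₁(f, r)` is at most `ε (1 - r) ^ (-α)`, so this part of the
reproducing formula is small in `B^{∞,1}_α`. -/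
lemma normBInf_rayPart_sdiff_le {K : ℝ} {m : ℕ} {α ε : ℝ} (hα : 0 < α)
    (hm : α - 1 < m) {f : E n → 𝕜} (hf : IsHarmonicOnBall f)
    (hK : ∀ A : Set ℝ, MeasurableSet A → A ⊆ Ioo 0 1 → ∀ ρ ∈ Ico (0 : ℝ) 1,
      M1 (rayPart m A f) ρ ≤ ENNReal.ofReal K *
        ∫⁻ r in A, M1 f r * ENNReal.ofReal ((1 - r) ^ (m : ℝ) / (1 - r * ρ) ^ ((m : ℝ) + 1))) :
    normBInf α (rayPart m (Ioo 0 1 \ L ε α f) f) ≤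
      ENNReal.ofReal K * ENNReal.ofReal (1 / α + 1 / (m - α + 1)) * ENNReal.ofReal ε := by
  have hAm : MeasurableSet (Ioo 0 1 \ L ε α f) := measurableSet_Ioo.diff (measurableSet_L ε α hf)
  refine iSup₂_le fun ρ hρ => ?_
  have hρ1 : 0 < 1 - ρ := sub_pos.2 hρ.2
  have ha : 0 < (m : ℝ) - α + 1 := by linarith
  have hFR := lintegral_one_sub_rpow_div_le (a := m - α + 1) (b := m + 1) ha (by linarith) hρ
  rw [show (m : ℝ) + 1 - (m - α + 1) = α by ring, show (m : ℝ) - α + 1 - (m + 1) = -α by ring,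
    show (m : ℝ) - α + 1 - 1 = m - α by ring] at hFR
  calc M1 (rayPart m (Ioo 0 1 \ L ε α f) f) ρ * ENNReal.ofReal ((1 - ρ) ^ α)
      ≤ ENNReal.ofReal K * (∫⁻ r in Ioo 0 1 \ L ε α f, ENNReal.ofReal ε *
          ENNReal.ofReal ((1 - r) ^ (m - α) / (1 - r * ρ) ^ ((m : ℝ) + 1))) *
          ENNReal.ofReal ((1 - ρ) ^ α) := by
        refine mul_le_mul_left ((hK _ hAm sdiff_subset ρ hρ).trans (mul_le_mul_right ?_ _)) _
        refine setLIntegral_mono' hAm fun r hr => ?_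
        rw [ofReal_rpow_mul_kernel (α := α) hr.1.2, ← mul_assoc]
        refine mul_le_mul_left ?_ _
        rw [mul_comm]
        by_contra hlt
        exact hr.2 ⟨⟨hr.1.1.le, hr.1.2⟩, (not_le.1 hlt).le⟩
    _ ≤ ENNReal.ofReal K * (ENNReal.ofReal ε *
          ENNReal.ofReal ((1 / α + 1 / (m - α + 1)) * (1 - ρ) ^ (-α))) *
          ENNReal.ofReal ((1 - ρ) ^ α) := by
        rw [lintegral_const_mul' _ _ ENNReal.ofReal_ne_top]
        exact mul_le_mul_left (mul_le_mul_right (mul_le_mul_right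
          ((lintegral_mono_set sdiff_subset).trans hFR) _) _) _
    _ = _ := by
        rw [ENNReal.ofReal_mul (by positivity)]
        have : ENNReal.ofReal ((1 - ρ) ^ (-α)) * ENNReal.ofReal ((1 - ρ) ^ α) = 1 := by
          rw [← ENNReal.ofReal_mul (by positivity), ← Real.rpow_add hρ1, neg_add_cancel,
            Real.rpow_zero, ENNReal.ofReal_one]
        calc _ = ENNReal.ofReal K * ENNReal.ofReal (1 / α + 1 / (m - α + 1)) * ENNReal.ofReal ε *
              (ENNReal.ofReal ((1 - ρ) ^ (-α)) * ENNReal.ofReal ((1 - ρ) ^ α)) := by ring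
          _ = _ := by rw [this, mul_one]

/-- The part of the reproducing formula over the level set lies in `B^{p,1}_α` as soon as the
level integral is finite. -/
lemma rayPart_L_mem_B {K : ℝ} {m : ℕ} {p α t ε : ℝ} (hp : 0 < p) (htm : t ≤ m)
    {f : E n → 𝕜} (hf : f ∈ BInf n 𝕜 α) (hε : levelIntegral p α t ε f < ∞)
    (hK : ∀ A : Set ℝ, MeasurableSet A → A ⊆ Ioo 0 1 → ∀ ρ ∈ Ico (0 : ℝ) 1,
      M1 (rayPart m A f) ρ ≤ ENNReal.ofReal K *
        ∫⁻ r in A, M1 f r * ENNReal.ofReal ((1 - r) ^ (m : ℝ) / (1 - r * ρ) ^ ((m : ℝ) + 1))) :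
    rayPart m (Ioo 0 1 ∩ L ε α f) f ∈ B n 𝕜 p α := by
  have hAm : MeasurableSet (Ioo 0 1 ∩ L ε α f) :=
    measurableSet_Ioo.inter (measurableSet_L ε α hf.1)
  refine ⟨isHarmonicOnBall_rayPart m hAm inter_subset_left hf.1, ?_⟩
  refine ENNReal.rpow_lt_top_of_nonneg (by positivity) (ne_of_lt ?_)
  set N := normBInf α f with hN
  have hNtop : ENNReal.ofReal K * N ≠ ∞ := ENNReal.mul_ne_top ENNReal.ofReal_ne_top hf.2.ne
  have hpt : ∀ ρ ∈ Ioo (0 : ℝ) 1, M1 (rayPart m (Ioo 0 1 ∩ L ε α f) f) ρ ^ p *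
      ENNReal.ofReal ((1 - ρ) ^ (α * p - 1)) ≤ (ENNReal.ofReal K * N) ^ p *
      ((∫⁻ r in Ioo (0 : ℝ) 1, (L ε α f).indicator
        (fun r => ENNReal.ofReal ((1 - r) ^ (t - α) / (1 - r * ρ) ^ (t + 1))) r) ^ p
      * ENNReal.ofReal ((1 - ρ) ^ (p * α - 1))) := by
    intro ρ hρ
    have hρ' : ρ ∈ Ico (0 : ℝ) 1 := ⟨hρ.1.le, hρ.2⟩
    rw [mul_comm α p, ← mul_assoc, ← ENNReal.mul_rpow_of_nonneg _ _ hp.le,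
      inner_levelIntegral_eq α t ε ρ hf.1]
    refine mul_le_mul_left (ENNReal.rpow_le_rpow ?_ hp.le) _
    refine (hK _ hAm inter_subset_left ρ hρ').trans ?_
    rw [mul_assoc]
    refine mul_le_mul_right ?_ _
    rw [← lintegral_const_mul' _ _ hf.2.ne]
    refine setLIntegral_mono' hAm fun r hr => ?_
    rw [ofReal_rpow_mul_kernel (α := α) hr.1.2, ← mul_assoc]
    refine mul_le_mul' ?_ (ENNReal.ofReal_le_ofReal (kernel_le_kernel htm hr.1 hρ' α))
    exact le_iSup₂ (f := fun r (_ : r ∈ Ico (0 : ℝ) 1) => M1 f r * ENNReal.ofReal ((1 - r) ^ α)) r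
      ⟨hr.1.1.le, hr.1.2⟩
  refine (setLIntegral_mono' measurableSet_Ioo hpt).trans_lt ?_
  rw [lintegral_const_mul' _ _ (ENNReal.rpow_ne_top_of_nonneg hp.le hNtop)]
  exact ENNReal.mul_lt_top (ENNReal.rpow_lt_top_of_nonneg hp.le hNtop) hε

lemma normBInf_congr {α : ℝ} {f g : E n → 𝕜} (h : EqOn f g (ball 0 1)) :
    normBInf α f = normBInf α g := by
  refine iSup_congr fun r => iSup_congr fun hr => ?_
  rw [M1, M1]
  congr 1
  exact lintegral_congr fun x => by rw [h (smul_mem_unitBall hr x)]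

/-- The distance is at most a constant times `s2`: the part of the reproducing formula over the
level set is an admissible competitor. -/
theorem exists_s1_le (n : ℕ) [NeZero n] (𝕜 : Type*) [RCLike 𝕜] {p α t : ℝ} (hp : 0 < p)
    (hα : 0 < α) (ht : α - 1 < t) :
    ∃ C : ℝ≥0, ∀ f ∈ BInf n 𝕜 α, s1 p α f ≤ C * s2 p α t f := by
  obtain ⟨m, htm⟩ := exists_nat_ge t
  obtain ⟨K, hK0, hK⟩ := exists_M1_rayPart_le n 𝕜 m
  set D : ℝ := K * (1 / α + 1 / (m - α + 1)) with hD
  have hD0 : 0 ≤ D := by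
    have : 0 < (m : ℝ) - α + 1 := by linarith
    positivity
  -- adding one makes the constant nonzero, so that it can be moved across the infimum in `s2`
  refine ⟨(D + 1).toNNReal, fun f hf => ?_⟩
  have hC : ((D + 1).toNNReal : ℝ≥0∞) ≠ 0 := (ENNReal.ofReal_pos.2 (by linarith)).ne'
  rw [← ENNReal.div_le_iff' hC ENNReal.coe_ne_top]
  refine le_iInf₂ fun ε hε => ?_
  rw [ENNReal.div_le_iff' hC ENNReal.coe_ne_top]
  refine (iInf₂_le _ (rayPart_L_mem_B hp htm hf hε.2 (hK f hf.1))).trans ?_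
  have heq : EqOn (f - rayPart m (Ioo 0 1 ∩ L ε α f) f) (rayPart m (Ioo 0 1 \ L ε α f) f)
      (ball 0 1) := fun x hx => by
    rw [Pi.sub_apply, sub_eq_iff_eq_add']
    exact (rayPart_add_rayPart m (measurableSet_L ε α hf.1) hf.1 hx).symm
  rw [normBInf_congr heq]
  refine (normBInf_rayPart_sdiff_le hα (ht.trans_le htm) hf.1 (hK f hf.1)).trans ?_
  refine mul_le_mul_left ?_ _
  rw [← ENNReal.ofReal_mul hK0]
  exact ENNReal.ofReal_le_ofReal (by linarith)

/-- If some `g ∈ B^{p,1}_α` is closer to `f` than `ε`, then the level integral of `f` at height `ε`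
is finite: `(1 - r) ^ α * M₁(g, r)` is bounded below on `L ε α f`. -/
lemma levelIntegral_lt_top {p α t ε : ℝ} [NeZero n] (hp : 0 < p) (hp1 : p ≤ 1) (hα : 0 < α)
    (ht : α - 1 < t) {f g : E n → 𝕜} (hf : IsHarmonicOnBall f) (hg : g ∈ B n 𝕜 p α)
    (h : normBInf α (f - g) < ENNReal.ofReal ε) : levelIntegral p α t ε f < ∞ := by
  obtain ⟨C, hC, hHardy⟩ := exists_lintegral_kernel_rpow_le hp hp1 hα ht
  have hgint : ∫⁻ r in Ioo (0 : ℝ) 1, M1 g r ^ p * ENNReal.ofReal ((1 - r) ^ (α * p - 1)) < ∞ :=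
    (ENNReal.rpow_lt_top_iff_of_pos (by positivity)).1 hg.2
  set η := ENNReal.ofReal ε - normBInf α (f - g) with hη
  have hη0 : η ≠ 0 := (tsub_pos_of_lt h).ne'
  have hηtop : η ≠ ∞ := (tsub_le_self.trans_lt ENNReal.ofReal_lt_top).ne
  have hfg : ContinuousOn (f - g) (ball 0 1) :=
    (isHarmonicOnBall_continuousOn hf).sub (isHarmonicOnBall_continuousOn hg.1)
  have hlow : ∀ r ∈ L ε α f, η ≤ ENNReal.ofReal ((1 - r) ^ α) * M1 g r := by
    intro r hr
    rw [hη, tsub_le_iff_left]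
    have h1 : M1 f r ≤ M1 (f - g) r + M1 g r := by
      simpa using M1_add_le (g := g) hfg hr.1
    refine (hr.2.trans (mul_le_mul_right h1 _)).trans ?_
    rw [mul_add, mul_comm _ (M1 (f - g) r)]
    gcongr
    exact le_iSup₂ (f := fun r (_ : r ∈ Ico (0 : ℝ) 1) =>
      M1 (f - g) r * ENNReal.ofReal ((1 - r) ^ α)) r hr.1
  have hpt : ∀ ρ ∈ Ioo (0 : ℝ) 1, (∫⁻ r in Ioo (0 : ℝ) 1, (L ε α f).indicator
        (fun r => ENNReal.ofReal ((1 - r) ^ (t - α) / (1 - r * ρ) ^ (t + 1))) r) ^ p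
      * ENNReal.ofReal ((1 - ρ) ^ (p * α - 1)) ≤ η⁻¹ ^ p * ((∫⁻ r in Ioo (0 : ℝ) 1,
          M1 g r * ENNReal.ofReal ((1 - r) ^ t / (1 - r * ρ) ^ (t + 1))) ^ p *
          ENNReal.ofReal ((1 - ρ) ^ (p * α - 1))) := by
    intro ρ _
    rw [← mul_assoc, ← ENNReal.mul_rpow_of_nonneg _ _ hp.le,
      inner_levelIntegral_eq α t ε ρ hf]
    refine mul_le_mul_left (ENNReal.rpow_le_rpow ?_ hp.le) _
    rw [← lintegral_const_mul' _ _ (ENNReal.inv_ne_top.2 hη0)]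
    refine (setLIntegral_mono' (measurableSet_Ioo.inter (measurableSet_L ε α hf))
      fun r hr => ?_).trans (lintegral_mono_set inter_subset_left)
    rw [ofReal_rpow_mul_kernel (α := α) (s := t) hr.1.2, ← mul_assoc, ← mul_assoc]
    refine le_mul_of_one_le_left' ?_
    rw [mul_assoc, mul_comm (M1 g r), ← ENNReal.inv_mul_cancel hη0 hηtop]
    exact mul_le_mul_right (hlow r hr.2) _
  refine (setLIntegral_mono' measurableSet_Ioo hpt).trans_lt ?_
  have hηp : η⁻¹ ^ p ≠ ∞ := ENNReal.rpow_ne_top_of_nonneg hp.le (ENNReal.inv_ne_top.2 hη0)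
  rw [lintegral_const_mul' _ _ hηp]
  exact ENNReal.mul_lt_top hηp.lt_top ((hHardy _ (monotoneOn_M1 hg.1)).trans_lt
    (ENNReal.mul_lt_top hC.lt_top hgint))

theorem s2_le_s1 {p α t : ℝ} [NeZero n] (hp : 0 < p) (hp1 : p ≤ 1) (hα : 0 < α)
    (ht : α - 1 < t) {f : E n → 𝕜} (hf : IsHarmonicOnBall f) : s2 p α t f ≤ s1 p α f := by
  refine le_iInf₂ fun g hg => le_of_forall_gt fun c hc => ?_
  obtain ⟨ε, hε1, hε2⟩ := ENNReal.lt_iff_exists_nnreal_btwn.1 hc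
  rw [← ENNReal.ofReal_coe_nnreal] at hε1 hε2
  have hε0 : (0 : ℝ) < ε := ENNReal.ofReal_pos.1 (bot_le.trans_lt hε1)
  exact (iInf₂_le (ε : ℝ) ⟨hε0, levelIntegral_lt_top hp hp1 hα ht hf hg hε1⟩).trans_lt hε2

end Decomposition

end HarmonicDist

end

theorem theorem4 {𝕜 : Type*} [RCLike 𝕜] (n : ℕ) (hn : 1 ≤ n) (p α t : ℝ)
    (hp : 0 < p) (hp1 : p ≤ 1) (hα : 0 < α) (ht : α - 1 < t) :
    ∃ C : ℝ≥0, ∀ f ∈ HarmonicDist.BInf n 𝕜 α,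
      HarmonicDist.s1 p α f ≤ C * HarmonicDist.s2 p α t f ∧
      HarmonicDist.s2 p α t f ≤ C * HarmonicDist.s1 p α f := by
  have : NeZero n := ⟨by omega⟩
  obtain ⟨C, hC⟩ := HarmonicDist.exists_s1_le n 𝕜 hp hα ht
  refine ⟨max C 1, fun f hf => ⟨(hC f hf).trans ?_,
    (HarmonicDist.s2_le_s1 hp hp1 hα ht hf.1).trans ?_⟩⟩
  · gcongr
    exact le_max_left _ _
  · refine le_mul_of_one_le_left' ?_
    exact_mod_cast le_max_right C 1
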